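/- **Setting.** Let $N\ge 2$ players have actions $x_i\in\mathbb R^{n_i}$, put $n=\sum_i n_i$, $x=(x_1,\dots,x_N)\in\mathbb R^n$, and let $J_i(x_i,x_{-i})$ be the cost of player $i$. The players communicate over an undirected connected graph with edge set $\mathcal E$ and symmetric weights $a_{ij}$, with $a_{ij}>0$ if $(i,j)\in\mathcal E$ and $a_{ij}=0$ otherwise; its weighted Laplacian has eigenvalues $0=\lambda_1<\lambda_2\le\dots\le\lambda_N$. *Assumption 1.* For each $i$ and each fixed $x_{-i}$, $J_i(\cdot,x_{-i})$ is continuously differentiable, strictly convex and radially unbounded on $\mathbb R^{n_i}$. *Assumption 2.* The map $F(x)=\mathrm{col}\{\nabla_iJ_i(x)\}_i$, where $\nabla_i$ is the gradient in $x_i$, satisfies $\langle F(x)-F(y),x-y\rangle\ge\mu\|x-y\|^2$ with $\mu>0$, and for each $i$ there are $\theta_i,\theta_{-i}\ge0$ such that $\nabla_iJ_i$ is $\theta_i$-Lipschitz in $x_i$ uniformly in $x_{-i}$ and $\theta_{-i}$-Lipschitz in $x_{-i}$ uniformly in $x_i$. Put $\theta=\max_i(\theta_i^2+\theta_{-i}^2)^{1/2}$.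 *Assumption 3.* The initial states (estimate vectors) $\boldsymbol x^i(0)\in\mathbb R^n$ of all players satisfy $\|\boldsymbol x^i(0)\|_\infty\le M$, and every Nash equilibrium $x^*$ satisfies $\|x^*\|_\infty\le M'$, where $M_0:=M+M'>0$. **Dynamics.** Let $q$ be the uniform quantizer with levels $-L,\dots,L$: $q(x)=0$ for $|x|<\frac12$, $q(x)=i$ for $\frac{2i-1}2\le x<\frac{2i+1}2$, $1\le i\le L$, $q(x)=L$ for $x\ge\frac{2L+1}2$, $q(x)=-q(-x)$ for $x\le-\frac12$; let $Q$ apply $q$ to each of the $n$ coordinates. With sampling period $T$ and scaling $s(k)=s(0)e^{-\gamma kT}$, player $j$ sends to its neighbours at time $kT$ the message $\mathbf q^j(0)=Q(\boldsymbol x^j(0)/s(0))$, $\mathbf q^j(k)=Q\big((\boldsymbol x^j(kT)-\widehat{\boldsymbol x}^j((k-1)T))/s(k)\big)$ for $k\ge1$, which costs $n\log_2(2L+1)$ bits. The decoded values are $\widehat{\boldsymbol x}^j(0)=s(0)\mathbf q^j(0)$, $\widehat{\boldsymbol x}^j(kT)=\widehat{\boldsymbol x}^j((k-1)T)+s(k)\mathbf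 q^j(k)$, held constant on $[kT,(k+1)T)$. The players follow $$\dot{\boldsymbol x}^i(t)=\alpha\sum_{j=1}^Na_{ij}\big(\widehat{\boldsymbol x}^j(t)-\widehat{\boldsymbol x}^i(t)\big)-R_i\nabla_iJ_i(\boldsymbol x^i(t)),$$ where $R_iv\in\mathbb R^n$ has $i$-th block $\varepsilon v$ and all other blocks zero. **Design rules.** A design $(\varepsilon,\alpha,\beta,a_1,a_2,T,L)$ is admissible if $\varepsilon,T>0$, $\beta,a_1\in(0,1)$, $0<a_2<1-a_1$, $\alpha>\frac{\varepsilon}{\lambda_2}\big(\frac{\theta^2}\mu+\theta\big)$, $L$ is a positive integer, and, with $$\nu=2\lambda_{\min}\begin{pmatrix}\frac\mu N&-\frac\theta{\sqrt N}\\-\frac\theta{\sqrt N}&\frac{\alpha\lambda_2}\varepsilon-\theta\end{pmatrix},\qquad \gamma=\frac{\varepsilon\nu\beta}4,\qquad \rho=\Big(\frac{\theta\varepsilon}{\alpha\lambda_N}+1\Big)\frac{8\alpha\lambda_N}{\nu^2\beta\varepsilon\sqrt{1-\beta}},$$ $$s(0)=\frac{a_2\varepsilon\nu M_0}{\alpha\lambda_N}\sqrt{1-\beta}\,e^{-\gamma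 T-\alpha\lambda_NT},$$ one has $(e^{\alpha\lambda_NT}-1)(e^{\gamma T}-1)\rho\varepsilon^{-1}\le a_1$ and $L\ge\max\Big\{\frac{M_0}{s(0)},\Big\lceil\frac{\sqrt{Nn}\,e^{\gamma T+\alpha\lambda_NT}}{2a_2}-\frac12\Big\rceil\Big\}$. The number $\gamma$ is the convergence rate of the design. Its bandwidth is $$\mathcal B=\max_{(j,i)\in\mathcal E}\ \limsup_{t\to\infty}\frac1t\sum_{k:\,kT\le t}r_{ji}(k),\qquad r_{ji}(k)=n\log_2(2L+1).$$ The minimum bandwidth required for rate $\gamma$ is the infimum of the bandwidths of all admissible designs of rate $\gamma$ with which the dynamics converges exponentially at rate $\gamma$ to a Nash equilibrium; that is, for all initial states allowed by Assumption 3 a solution exists on $[0,\infty)$, and there are a Nash equilibrium $x^*$ and a constant $C$ such that every such solution satisfies $\|\boldsymbol x(t)-1_N\otimes x^*\|\le Ce^{-\gamma t}$ for all $t\ge0$. **Theorem 3.** Under Assumptions 1 and 2 there are constants $c_1,c_2>0$, depending only on the game and the graph (not on $\mathcal B$, $\gamma$, $M$, $M'$), such that, under Assumption 3, for every $\gamma>0$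 there is an admissible design of rate $\gamma$ with which the dynamics converges exponentially at rate $\gamma$ to a Nash equilibrium and whose bandwidth is at most $c_1\gamma+c_2$. In particular the minimum bandwidth $\mathcal B$ required for rate $\gamma$ satisfies $$\mathcal B\le c_1\gamma+c_2 .$$ -/

import Mathlib

noncomputable section

open Filter Topology

namespace QuantizedNash

/-! ### Communication graph -/

/-- An undirected weighted graph on `N` vertices: an edge set together with a symmetric
adjacency matrix `[a i j]`, positive exactly on the edges and zero elsewhere. -/
structure CommGraph (N : ℕ) where
  graph : SimpleGraph (Fin N)
  weight : Fin N → Fin N → ℝ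
  symm : ∀ i j, weight i j = weight j i
  pos : ∀ i j, graph.Adj i j → 0 < weight i j
  zero : ∀ i j, ¬ graph.Adj i j → weight i j = 0

/-- The weighted Laplacian. -/
def CommGraph.laplacian {N : ℕ} (W : CommGraph N) : Matrix (Fin N) (Fin N) ℝ :=
  Matrix.of fun i j => if i = j then ∑ k ∈ Finset.univ.erase i, W.weight i k else -W.weight i j

theorem CommGraph.laplacian_isHermitian {N : ℕ} (W : CommGraph N) :
    W.laplacian.IsHermitian := by
  ext i j
  by_cases h : i = j
  · subst h
    simp [CommGraph.laplacian]
  · have h' : j ≠ i := fun e => h e.symm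
    simp [CommGraph.laplacian, h, h', W.symm i j]

/-- The eigenvalues, with multiplicity, of a real symmetric matrix in ascending order
(Mathlib's `eigenvalues₀` lists them in descending order); the index starts at `0`. -/
def ascEig {m : ℕ} {A : Matrix (Fin m) (Fin m) ℝ} (hA : A.IsHermitian) (k : Fin m) : ℝ :=
  hA.eigenvalues₀ (Fin.cast (Fintype.card_fin m).symm k.rev)

/-- `λ₂`, the second smallest Laplacian eigenvalue. -/
def CommGraph.lam2 {N : ℕ} (W : CommGraph N) (hN : 2 ≤ N) : ℝ :=
  ascEig W.laplacian_isHermitian ⟨1, by omega⟩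

/-- `λ_N`, the largest Laplacian eigenvalue. -/
def CommGraph.lamN {N : ℕ} (W : CommGraph N) (hN : 2 ≤ N) : ℝ :=
  ascEig W.laplacian_isHermitian ⟨N - 1, by omega⟩

/-! ### The game -/

/-- Action profiles `x = (x_1, …, x_N)`, `x_i ∈ ℝ^{n_i}`, with the Euclidean norm; this is `ℝⁿ`
with `n = ∑ n_i`. -/
abbrev Profile {N : ℕ} (d : Fin N → ℕ) : Type :=
  PiLp 2 fun i : Fin N => EuclideanSpace ℝ (Fin (d i))

/-- Stacked estimates `(𝒙^1, …, 𝒙^N)`, one profile for each player, with the Euclidean norm. -/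
abbrev Stack {N : ℕ} (d : Fin N → ℕ) : Type :=
  PiLp 2 fun _ : Fin N => Profile d

variable {N : ℕ} {d : Fin N → ℕ}

/-- The profile `(z, x_{-i})`. -/
def replaceAction (x : Profile d) (i : Fin N) (z : EuclideanSpace ℝ (Fin (d i))) : Profile d :=
  WithLp.toLp 2 (Function.update (WithLp.ofLp x) i z)

/-- `‖x‖_∞ ≤ M`. -/
def SupBound (x : Profile d) (M : ℝ) : Prop :=
  ∀ (i : Fin N) (c : Fin (d i)), |x i c| ≤ M

/-- Nash equilibria: no player can lower its own cost by a unilateral change of action. -/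
def IsNash (J : Fin N → Profile d → ℝ) (x : Profile d) : Prop :=
  ∀ (i : Fin N) (z : EuclideanSpace ℝ (Fin (d i))), J i x ≤ J i (replaceAction x i z)

/-- The partial gradient `∇_i J_i (x_i, x_{-i})` with respect to the player's own action. -/
def ownGrad (J : Fin N → Profile d → ℝ) (i : Fin N) (x : Profile d) :
    EuclideanSpace ℝ (Fin (d i)) :=
  gradient (fun z => J i (replaceAction x i z)) (x i)

/-- The game mapping `F(x) = col{∇_i J_i(x)}`. -/
def gameMap (J : Fin N → Profile d → ℝ) (x : Profile d) : Profile d :=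
  WithLp.toLp 2 fun i => ownGrad J i x

/-- Each `J_i(·, x_{-i})` is continuously differentiable, strictly convex and radially
unbounded. -/
structure RegularCosts (J : Fin N → Profile d → ℝ) : Prop where
  contDiff : ∀ i x, ContDiff ℝ 1 fun z => J i (replaceAction x i z)
  strictConvex : ∀ i x, StrictConvexOn ℝ Set.univ fun z => J i (replaceAction x i z)
  unbounded : ∀ i x, Tendsto (fun z => J i (replaceAction x i z)) (Bornology.cobounded _) atTop

/-- The game mapping is `μ`-strongly monotone, and `∇_i J_i` is `θ_i`-Lipschitz in `x_i` and
`θ_{-i}`-Lipschitz in `x_{-i}`, uniformly in the other variable. -/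
structure MonotoneLipschitz (J : Fin N → Profile d → ℝ) (μ : ℝ) (θown θother : Fin N → ℝ) :
    Prop where
  mu_pos : 0 < μ
  own_nonneg : ∀ i, 0 ≤ θown i
  other_nonneg : ∀ i, 0 ≤ θother i
  strongMono : ∀ x y : Profile d, μ * ‖x - y‖ ^ 2 ≤ inner ℝ (gameMap J x - gameMap J y) (x - y)
  lip_own : ∀ (i : Fin N) (x y : Profile d), (∀ j, j ≠ i → x j = y j) →
    ‖ownGrad J i x - ownGrad J i y‖ ≤ θown i * ‖x i - y i‖
  lip_other : ∀ (i : Fin N) (x y : Profile d), x i = y i →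
    ‖ownGrad J i x - ownGrad J i y‖ ≤ θother i * ‖x - y‖

/-- `θ`, the largest of the numbers `(θ_i² + θ_{-i}²)^{1/2}`. -/
def theta (θown θother : Fin N → ℝ) : ℝ :=
  ⨆ i, Real.sqrt (θown i ^ 2 + θother i ^ 2)

/-! ### Quantizer, encoder and decoder -/

/-- The uniform quantizer with values in `{-L, …, L}`: rounding to a nearest integer (ties away
from zero), saturated at `±L`. -/
def quantize (L : ℕ) (x : ℝ) : ℤ :=
  if x ≤ -(1 / 2) then -min (L : ℤ) ⌊-x + 1 / 2⌋ else min (L : ℤ) ⌊x + 1 / 2⌋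

/-- The componentwise quantizer on `ℝⁿ`. -/
def quantizeVec (L : ℕ) (x : Profile d) : Profile d :=
  WithLp.toLp 2 fun i => WithLp.toLp 2 fun c => (quantize L (x i c) : ℝ)

/-- The decoded value after `k` steps, for the scaling `s` and the samples `y k` of one player:
the message is `q(0) = Q(y(0)/s(0))` and `q(k+1) = Q((y(k+1) - ŷ(k))/s(k+1))`, the decoder is
`ŷ(0) = s(0) q(0)` and `ŷ(k+1) = ŷ(k) + s(k+1) q(k+1)`. -/
def decode (L : ℕ) (s : ℕ → ℝ) (y : ℕ → Profile d) : ℕ → Profile d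
  | 0 => s 0 • quantizeVec L ((s 0)⁻¹ • y 0)
  | k + 1 => decode L s y k +
      s (k + 1) • quantizeVec L ((s (k + 1))⁻¹ • (y (k + 1) - decode L s y k))

/-! ### Parameters -/

/-- The numbers through which the parameter design depends on the game and the graph: the number
of players, the dimension `n`, `λ₂`, `λ_N`, `μ`, `θ` and `M₀`. -/
structure Consts where
  N : ℕ
  n : ℕ
  lam2 : ℝ
  lamN : ℝ
  μ : ℝ
  θ : ℝ
  M0 : ℝ

/-- The free parameters of the algorithm. -/
structure Design where
  ε : ℝ
  α : ℝ
  β : ℝ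
  a1 : ℝ
  a2 : ℝ
  T : ℝ
  L : ℕ

/-- The symmetric `2 × 2` matrix whose smallest eigenvalue is `ν / 2`. -/
def rateMatrix (c : Consts) (p : Design) : Matrix (Fin 2) (Fin 2) ℝ :=
  !![c.μ / c.N, -(c.θ / Real.sqrt c.N);
     -(c.θ / Real.sqrt c.N), p.α * c.lam2 / p.ε - c.θ]

theorem rateMatrix_isHermitian (c : Consts) (p : Design) : (rateMatrix c p).IsHermitian := by
  ext i j
  fin_cases i <;> fin_cases j <;> simp [rateMatrix]

def nu (c : Consts) (p : Design) : ℝ := 2 * ascEig (rateMatrix_isHermitian c p) 0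

/-- The convergence rate `γ = ενβ/4` of a design. -/
def rate (c : Consts) (p : Design) : ℝ := p.ε * nu c p * p.β / 4

def rho (c : Consts) (p : Design) : ℝ :=
  (c.θ * p.ε / (p.α * c.lamN) + 1) *
    (8 * p.α * c.lamN / (nu c p ^ 2 * p.β * p.ε * Real.sqrt (1 - p.β)))

def s0 (c : Consts) (p : Design) : ℝ :=
  p.a2 * p.ε * nu c p * c.M0 / (p.α * c.lamN) * Real.sqrt (1 - p.β) *
    Real.exp (-rate c p * p.T - p.α * c.lamN * p.T)

/-- The scaling function `s(k) = s(0) e^{-γkT}`. -/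
def scaling (c : Consts) (p : Design) (k : ℕ) : ℝ :=
  s0 c p * Real.exp (-rate c p * k * p.T)

/-- The design rules for the parameters. -/
structure Admissible (c : Consts) (p : Design) : Prop where
  eps_pos : 0 < p.ε
  gain : p.ε / c.lam2 * (c.θ ^ 2 / c.μ + c.θ) < p.α
  beta_pos : 0 < p.β
  beta_lt : p.β < 1
  a1_pos : 0 < p.a1
  a1_lt : p.a1 < 1
  a2_pos : 0 < p.a2
  a2_lt : p.a2 < 1 - p.a1
  period_pos : 0 < p.T
  period : (Real.exp (p.α * c.lamN * p.T) - 1) * (Real.exp (rate c p * p.T) - 1) *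
    rho c p * p.ε⁻¹ ≤ p.a1
  level_pos : 0 < p.L
  level_init : c.M0 / s0 c p ≤ p.L
  level : ⌈Real.sqrt (c.N * c.n) * Real.exp (rate c p * p.T + p.α * c.lamN * p.T) / (2 * p.a2)
    - 1 / 2⌉ ≤ (p.L : ℤ)

/-! ### The closed loop -/

/-- `𝒙̂^i(t)`: the last decoded value, held constant between the sampling instants `kT`. -/
def estimate (c : Consts) (p : Design) (x : ℝ → Stack d) (i : Fin N) (t : ℝ) : Profile d :=
  decode p.L (scaling c p) (fun k => x (k * p.T) i) ⌊t / p.T⌋₊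

/-- The right-hand side
`α ∑_j a_ij (𝒙̂^j(t) - 𝒙̂^i(t)) - R_i ∇_i J_i(𝒙^i(t))`, `i = 1, …, N`, where `R_i v` is the profile
with `i`-th block `ε v` and all other blocks zero. -/
def velocity (W : CommGraph N) (J : Fin N → Profile d → ℝ) (c : Consts) (p : Design)
    (x : ℝ → Stack d) (t : ℝ) : Stack d :=
  WithLp.toLp 2 fun i =>
    p.α • ∑ j, W.weight i j • (estimate c p x j t - estimate c p x i t) -
      WithLp.toLp 2 (Pi.single i (p.ε • ownGrad J i (x t i)))

/-- Solutions on `[0, ∞)`. The right-hand side jumps at the sampling instants, so a solution is a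
continuous curve that satisfies the equation at every time with the right derivative. -/
def IsSolution (W : CommGraph N) (J : Fin N → Profile d → ℝ) (c : Consts) (p : Design)
    (x : ℝ → Stack d) : Prop :=
  ContinuousOn x (Set.Ici 0) ∧
    ∀ t, 0 ≤ t → HasDerivWithinAt x (velocity W J c p x t) (Set.Ici t) t

/-- For all initial states bounded by `M` the closed loop has a solution, and all these solutions
converge to one and the same Nash equilibrium with exponential rate `γ`. -/
def ConvergesToNash (W : CommGraph N) (J : Fin N → Profile d → ℝ) (c : Consts) (p : Design)
    (M γ : ℝ) : Prop :=
  (∀ z : Stack d, (∀ i, SupBound (z i) M) → ∃ x, IsSolution W J c p x ∧ x 0 = z) ∧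
  ∃ xs : Profile d, IsNash J xs ∧ ∃ C : ℝ, ∀ x : ℝ → Stack d, IsSolution W J c p x →
    (∀ i, SupBound (x 0 i) M) →
      ∀ t, 0 ≤ t → ‖x t - WithLp.toLp 2 (fun _ => xs)‖ ≤ C * Real.exp (-γ * t)

/-! ### Bandwidth -/

/-- `max_{(j,i) ∈ E} limsup_{t → ∞} (1/t) ∑_{kT ≤ t} r_{ji}(k)`, in bits per unit of time. -/
def bandwidth (W : CommGraph N) (T : ℝ) (r : Fin N → Fin N → ℕ → ℝ) : ℝ :=
  ⨆ e : {e : Fin N × Fin N // W.graph.Adj e.1 e.2},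
    limsup (fun t : ℝ => 1 / t * ∑ k ∈ Finset.range (⌊t / T⌋₊ + 1), r e.1.1 e.1.2 k) atTop

/-- The bandwidth of a design: every message is one value of the quantizer on `ℝⁿ`, that is
`n log₂ (2L + 1)` bits. -/
def designBandwidth (W : CommGraph N) (c : Consts) (p : Design) : ℝ :=
  bandwidth W p.T fun _ _ _ => (c.n : ℝ) * Real.logb 2 (2 * (p.L : ℝ) + 1)

/-- The constants attached to a game and a graph. -/
def consts (W : CommGraph N) (hN : 2 ≤ N) (d : Fin N → ℕ) (μ : ℝ) (θown θother : Fin N → ℝ)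
    (M M' : ℝ) : Consts where
  N := N
  n := ∑ i, d i
  lam2 := W.lam2 hN
  lamN := W.lamN hN
  μ := μ
  θ := theta θown θother
  M0 := M + M'

/-- The bandwidths with which convergence rate `γ` is achieved: those of the admissible designs
of rate `γ` for which the closed loop converges to a Nash equilibrium with this rate. -/
def sufficientBandwidths (W : CommGraph N) (J : Fin N → Profile d → ℝ) (c : Consts) (M γ : ℝ) :
    Set ℝ :=
  {B | ∃ p : Design, Admissible c p ∧ rate c p = γ ∧ ConvergesToNash W J c p M γ ∧
    B = designBandwidth W c p}

/-- The minimum bandwidth required for convergence rate `γ`. -/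
def minBandwidth (W : CommGraph N) (J : Fin N → Profile d → ℝ) (c : Consts) (M γ : ℝ) : ℝ :=
  sInf (sufficientBandwidths W J c M γ)

end QuantizedNash

end

open QuantizedNash

/-!
Let `x*` be the zero of the game mapping and `y = x - 1 ⊗ x*` the stacked error. Once the ratio
`α / ε` is large, the spectral gap of the graph controls the disagreement part of `y` and strong
monotonicity its consensus part, so that the loop with exact communication contracts `‖y‖`. Over
one period the decoded values are out of date by an amount proportional to `T`; with a short period
and a fine quantizer this perturbation is absorbed by the contraction, and the sampled errors stay
below the geometric sequence along which the scaling `s(k)` decreases.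

Taking `ε` and `α` proportional to `γ` rescales time by `γ`, so that the loop estimates involve only
the product `γT`. Hence `T = τ / (γ + 1)` and a number of levels `L` independent of `γ` suffice, and
the bit rate `r / T = r (γ + 1) / τ` is affine in `γ`.
-/

noncomputable section

open Filter Topology
open scoped NNReal

namespace QuantizedNash

variable {N : ℕ} {d : Fin N → ℕ}

section DifferentialEquations

variable {E : Type*} [NormedAddCommGroup E] [NormedSpace ℝ E]

theorem exists_hasDerivWithinAt_Icc_of_lipschitzWith [CompleteSpace E] {f : E → E} {K : ℝ≥0}
    (hf : LipschitzWith K f) {h : ℝ} (hh : 0 ≤ h) (hK : K * h ≤ 1 / 2) (x₀ : E) :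
    ∃ X : ℝ → E, X 0 = x₀ ∧ ∀ t ∈ Set.Icc 0 h, HasDerivWithinAt X (f (X t)) (Set.Icc 0 h) t := by
  set R : ℝ≥0 := ⟨2 * h * ‖f x₀‖, by positivity⟩
  have hR : (R : ℝ) = 2 * h * ‖f x₀‖ := rfl
  have hpl : IsPicardLindelof (fun _ => f) (⟨0, by simp [hh]⟩ : Set.Icc (0 : ℝ) h) x₀ R 0
      (K * R + ‖f x₀‖₊) K := by
    refine .of_time_independent (fun x hx => ?_) hf.lipschitzOnWith ?_
    · have hball : dist x x₀ ≤ R := hx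
      calc ‖f x‖ ≤ ‖f x - f x₀‖ + ‖f x₀‖ := norm_le_norm_sub_add _ _
        _ ≤ K * dist x x₀ + ‖f x₀‖ := by rw [← dist_eq_norm]; gcongr; exact hf.dist_le_mul x x₀
        _ ≤ K * R + ‖f x₀‖ := by gcongr
        _ = (K * R + ‖f x₀‖₊ : ℝ≥0) := by push_cast; rfl
    · simp only [sub_zero, sub_self, NNReal.coe_add, NNReal.coe_mul, coe_nnnorm, NNReal.coe_zero,
        max_eq_left hh, hR]
      have : (K * h) * (2 * h * ‖f x₀‖) ≤ 1 / 2 * (2 * h * ‖f x₀‖) := by gcongr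
      linarith
  exact hpl.exists_eq_forall_mem_Icc_hasDerivWithinAt₀

theorem exp_sub_one_le_two_mul {x : ℝ} (h0 : 0 ≤ x) (h1 : x ≤ 1) : Real.exp x - 1 ≤ 2 * x := by
  have h := (le_abs_self _).trans (Real.abs_exp_sub_one_le (by rwa [abs_of_nonneg h0]))
  rwa [abs_of_nonneg h0] at h

theorem exp_neg_mul_le_two_mul {γ a t : ℝ} (h : γ * (t - a) ≤ 1 / 2) :
    Real.exp (-γ * a) ≤ 2 * Real.exp (-γ * t) := by
  have hlog := Real.add_one_le_exp (-γ * t - -γ * a)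
  rw [Real.exp_sub, le_div_iff₀ (Real.exp_pos _)] at hlog
  have hhalf : 1 / 2 * Real.exp (-γ * a) ≤ (-γ * t - -γ * a + 1) * Real.exp (-γ * a) := by
    gcongr
    linarith
  linarith

theorem gronwallBound_zero_le {K ε x : ℝ} (hK : 0 ≤ K) (hε : 0 ≤ ε) (hx : 0 ≤ x)
    (hKx : K * x ≤ 1) : gronwallBound 0 K ε x ≤ 2 * ε * x := by
  rcases hK.eq_or_lt with rfl | hK
  · rw [gronwallBound_K0]
    linarith [mul_nonneg hε hx]
  · simp only [gronwallBound_of_K_ne_0 hK.ne', zero_mul, zero_add]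
    calc ε / K * (Real.exp (K * x) - 1) ≤ ε / K * (2 * (K * x)) := by
          gcongr
          exact exp_sub_one_le_two_mul (by positivity) hKx
      _ = 2 * ε * x := by field_simp

theorem norm_sub_le_of_norm_deriv_right_le {y y' : ℝ → E} {a b K c : ℝ}
    (hy : ContinuousOn y (Set.Icc a b))
    (hy' : ∀ t ∈ Set.Ico a b, HasDerivWithinAt y (y' t) (Set.Ici t) t)
    (hK : 0 ≤ K) (hc : 0 ≤ c) (hKab : K * (b - a) ≤ 1)
    (hbound : ∀ t ∈ Set.Ico a b, ‖y' t‖ ≤ K * ‖y t - y a‖ + c) {t : ℝ} (ht : t ∈ Set.Icc a b) :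
    ‖y t - y a‖ ≤ 2 * c * (t - a) := by
  refine (norm_le_gronwallBound_of_norm_deriv_right_le (f := fun t => y t - y a)
    (hy.sub continuousOn_const) (fun t ht => (hy' t ht).sub_const _) (by simp) hbound t ht).trans
    (gronwallBound_zero_le hK hc (sub_nonneg.2 ht.1) (le_trans ?_ hKab))
  gcongr
  exact ht.2

end DifferentialEquations

section HeldFeedback

variable {H : Type*} [NormedAddCommGroup H] [InnerProductSpace ℝ H]

theorem norm_le_mul_exp_of_inner_deriv_right_lt {y y' : ℝ → H} {a b γ Y : ℝ}
    (hy : ContinuousOn y (Set.Icc a b))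
    (hy' : ∀ t ∈ Set.Ico a b, HasDerivWithinAt y (y' t) (Set.Ici t) t)
    (hY : 0 ≤ Y) (hya : ‖y a‖ ≤ Y * Real.exp (-γ * a))
    (hlt : ∀ t ∈ Set.Ico a b, ‖y t‖ = Y * Real.exp (-γ * t) →
      inner ℝ (y t) (y' t) < -γ * ‖y t‖ ^ 2) {t : ℝ} (ht : t ∈ Set.Icc a b) :
    ‖y t‖ ≤ Y * Real.exp (-γ * t) := by
  have hderiv (t : ℝ) : HasDerivAt (fun t => (Y * Real.exp (-γ * t)) ^ 2)
      (2 * (-γ * (Y * Real.exp (-γ * t)) ^ 2)) t := by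
    refine (((((hasDerivAt_id t).const_mul (-γ)).exp).const_mul Y).pow 2).congr_deriv ?_
    simp only [id, Nat.cast_ofNat]
    ring
  refine le_of_sq_le_sq (image_le_of_deriv_right_lt_deriv_boundary (f := fun t => ‖y t‖ ^ 2)
    (hy.norm.pow 2) (fun t ht => (hy' t ht).norm_sq) (pow_le_pow_left₀ (norm_nonneg _) hya 2)
    hderiv (fun t ht heq => ?_) ht) (by positivity)
  have hnorm := (pow_left_inj₀ (norm_nonneg (y t)) (by positivity) two_ne_zero).1 heq
  rw [← heq]
  linarith [hlt t ht hnorm]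

/-- A vector field `v ↦ -(A v + r v)`, split into the part `A` that acts on held data and the part
`r` that acts on the current state, which contracts towards `0` at rate `2 γ` and whose two parts
grow at most at rate `C γ`. -/
structure IsDissipative (A : H →L[ℝ] H) (r : H → H) (γ C : ℝ) : Prop where
  coercive : ∀ v, 2 * γ * ‖v‖ ^ 2 ≤ inner ℝ v (A v + r v)
  norm_held_le : ∀ v, ‖A v‖ ≤ C * γ * ‖v‖
  norm_current_le : ∀ v, ‖r v‖ ≤ C * γ * ‖v‖

namespace IsDissipative

variable {A : H →L[ℝ] H} {r : H → H} {γ C a b Y : ℝ} {y : ℝ → H} {h : H}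

theorem norm_sub_left_le (hAr : IsDissipative A r γ C) (hγ : 0 ≤ γ) (hC : 0 ≤ C)
    (hCab : C * γ * (b - a) ≤ 1) (hy : ContinuousOn y (Set.Icc a b))
    (hy' : ∀ t ∈ Set.Ico a b, HasDerivWithinAt y (-A h - r (y t)) (Set.Ici t) t) {t : ℝ}
    (ht : t ∈ Set.Icc a b) :
    ‖y t - y a‖ ≤ 2 * (C * γ * (‖h‖ + ‖y a‖)) * (t - a) := by
  refine norm_sub_le_of_norm_deriv_right_le hy hy' (by positivity) (by positivity) hCab
    (fun t _ => ?_) ht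
  have hcurrent : ‖y t‖ ≤ ‖y t - y a‖ + ‖y a‖ := norm_le_norm_sub_add _ _
  calc ‖-A h - r (y t)‖ ≤ ‖A h‖ + ‖r (y t)‖ := by simpa using norm_sub_le (-A h) (r (y t))
    _ ≤ C * γ * ‖h‖ + C * γ * (‖y t - y a‖ + ‖y a‖) :=
        add_le_add (hAr.norm_held_le h) ((hAr.norm_current_le _).trans (by gcongr))
    _ = C * γ * ‖y t - y a‖ + C * γ * (‖h‖ + ‖y a‖) := by ring

theorem norm_held_sub_le (hAr : IsDissipative A r γ C) (hγ : 0 < γ) (hC : 1 ≤ C)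
    (hCab : 32 * C ^ 2 * γ * (b - a) ≤ 1) (hy : ContinuousOn y (Set.Icc a b))
    (hy' : ∀ t ∈ Set.Ico a b, HasDerivWithinAt y (-A h - r (y t)) (Set.Ici t) t)
    (hya : ‖y a‖ ≤ Y * Real.exp (-γ * a))
    (hha : ‖h - y a‖ ≤ Y / (16 * C) * Real.exp (-γ * a)) {t : ℝ} (ht : t ∈ Set.Icc a b) :
    ‖h - y t‖ ≤ Y / (2 * C) * Real.exp (-γ * t) := by
  have hCγ : C * γ * (b - a) ≤ 1 / (32 * C) := by
    rw [le_div_iff₀ (by positivity)]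
    linarith
  have hCγ1 : C * γ * (b - a) ≤ 1 := hCγ.trans (div_le_one_of_le₀ (by linarith) (by positivity))
  have hexp : Real.exp (-γ * a) ≤ 2 * Real.exp (-γ * t) := by
    refine exp_neg_mul_le_two_mul ?_
    calc γ * (t - a) ≤ C * γ * (b - a) :=
          mul_le_mul (le_mul_of_one_le_left hγ.le hC) (by linarith [ht.2]) (by linarith [ht.1])
            (by positivity)
      _ ≤ 1 / (32 * C) := hCγ
      _ ≤ 1 / 2 := by gcongr; linarith
  set D := Real.exp (-γ * a)
  have hY : 0 ≤ Y := nonneg_of_mul_nonneg_left ((norm_nonneg _).trans hya) (Real.exp_pos _)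
  have hYC : Y / (16 * C) * D ≤ Y * D / 16 := by
    rw [div_mul_eq_mul_div]
    gcongr
    linarith
  have hsum : ‖h‖ + ‖y a‖ ≤ 33 / 16 * (Y * D) := by
    linarith [norm_le_norm_sub_add h (y a)]
  calc ‖h - y t‖ ≤ ‖h - y a‖ + ‖y t - y a‖ := by simpa using norm_sub_le (h - y a) (y t - y a)
    _ ≤ Y / (16 * C) * D + 2 * (C * γ * (33 / 16 * (Y * D))) * (b - a) := by
        refine add_le_add hha ((hAr.norm_sub_left_le hγ.le (by positivity) hCγ1 hy hy' ht).trans ?_)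
        gcongr
        exacts [sub_nonneg.2 ht.1, ht.2]
    _ = Y / (16 * C) * D + 33 / 8 * (Y * D) * (C * γ * (b - a)) := by ring
    _ ≤ Y / (16 * C) * D + 33 / 8 * (Y * D) * (1 / (32 * C)) := by gcongr
    _ = 49 / 64 * (Y / (4 * C) * D) := by field_simp; ring
    _ ≤ 1 * (Y / (4 * C) * (2 * Real.exp (-γ * t))) := by gcongr; norm_num
    _ = Y / (2 * C) * Real.exp (-γ * t) := by ring

theorem norm_le_mul_exp (hAr : IsDissipative A r γ C) (hγ : 0 < γ) (hC : 1 ≤ C)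
    (hCab : 32 * C ^ 2 * γ * (b - a) ≤ 1) (hy : ContinuousOn y (Set.Icc a b))
    (hy' : ∀ t ∈ Set.Ico a b, HasDerivWithinAt y (-A h - r (y t)) (Set.Ici t) t) (hY : 0 < Y)
    (hya : ‖y a‖ ≤ Y * Real.exp (-γ * a))
    (hha : ‖h - y a‖ ≤ Y / (16 * C) * Real.exp (-γ * a)) {t : ℝ} (ht : t ∈ Set.Icc a b) :
    ‖y t‖ ≤ Y * Real.exp (-γ * t) := by
  refine norm_le_mul_exp_of_inner_deriv_right_lt hy hy' hY.le hya (fun t ht heq => ?_) ht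
  have hpos : 0 < ‖y t‖ := heq ▸ by positivity
  have herr : ‖A (y t - h)‖ ≤ γ / 2 * ‖y t‖ := by
    calc ‖A (y t - h)‖ ≤ C * γ * ‖y t - h‖ := hAr.norm_held_le _
      _ ≤ C * γ * (Y / (2 * C) * Real.exp (-γ * t)) := by
        rw [norm_sub_rev]
        gcongr
        exact hAr.norm_held_sub_le hγ hC hCab hy hy' hya hha (Set.Ico_subset_Icc_self ht)
      _ = γ / 2 * ‖y t‖ := by rw [heq]; field_simp
  have hsplit : -A h - r (y t) = A (y t - h) - (A (y t) + r (y t)) := by rw [map_sub]; abel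
  calc inner ℝ (y t) (-A h - r (y t))
      = inner ℝ (y t) (A (y t - h)) - inner ℝ (y t) (A (y t) + r (y t)) := by
        rw [hsplit, inner_sub_right]
    _ ≤ ‖y t‖ * (γ / 2 * ‖y t‖) - 2 * γ * ‖y t‖ ^ 2 :=
        sub_le_sub ((real_inner_le_norm _ _).trans (by gcongr)) (hAr.coercive _)
    _ = -γ * ‖y t‖ ^ 2 - γ / 2 * ‖y t‖ ^ 2 := by ring
    _ < -γ * ‖y t‖ ^ 2 := sub_lt_self _ (by positivity)

end IsDissipative

end HeldFeedback

section StronglyMonotone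

variable {H : Type*} [NormedAddCommGroup H] [InnerProductSpace ℝ H] {F : H → H} {μ : ℝ} {K : ℝ≥0}

theorem norm_sub_smul_sub_sq_le
    (hmono : ∀ x y, μ * ‖x - y‖ ^ 2 ≤ inner ℝ (F x - F y) (x - y)) (hlip : LipschitzWith K F)
    {τ : ℝ} (hτ : 0 ≤ τ) (x y : H) :
    ‖(x - τ • F x) - (y - τ • F y)‖ ^ 2 ≤ (1 - 2 * τ * μ + τ ^ 2 * K ^ 2) * ‖x - y‖ ^ 2 := by
  have hF : ‖F x - F y‖ ^ 2 ≤ K ^ 2 * ‖x - y‖ ^ 2 := by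
    rw [← mul_pow]
    exact pow_le_pow_left₀ (norm_nonneg _) (hlip.norm_sub_le x y) 2
  calc ‖(x - τ • F x) - (y - τ • F y)‖ ^ 2
      = ‖(x - y) - τ • (F x - F y)‖ ^ 2 := by rw [smul_sub]; congr 2; abel
    _ = ‖x - y‖ ^ 2 - 2 * τ * inner ℝ (F x - F y) (x - y) + τ ^ 2 * ‖F x - F y‖ ^ 2 := by
        rw [norm_sub_sq_real, real_inner_smul_right, norm_smul, real_inner_comm, mul_pow,
          Real.norm_eq_abs, sq_abs]
        ring
    _ ≤ ‖x - y‖ ^ 2 - 2 * τ * (μ * ‖x - y‖ ^ 2) + τ ^ 2 * (K ^ 2 * ‖x - y‖ ^ 2) := by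
        gcongr
        exact hmono x y
    _ = _ := by ring

theorem exists_eq_zero_of_strongly_monotone [CompleteSpace H] (hμ : 0 < μ)
    (hmono : ∀ x y, μ * ‖x - y‖ ^ 2 ≤ inner ℝ (F x - F y) (x - y)) (hlip : LipschitzWith K F) :
    ∃ x, F x = 0 := by
  set τ := μ / ((K : ℝ) ^ 2 + μ ^ 2) with hτ
  have hτpos : 0 < τ := by positivity
  have hτmul : τ * (K ^ 2 + μ ^ 2) = μ := by rw [hτ]; field_simp
  have hτμ : τ * μ ≤ 1 := by
    rw [hτ, div_mul_eq_mul_div, div_le_one (by positivity)]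
    nlinarith [sq_nonneg (K : ℝ)]
  have hfactor : 1 - 2 * τ * μ + τ ^ 2 * K ^ 2 ≤ 1 - τ * μ := by
    nlinarith [sq_nonneg (τ * μ)]
  have hcontr : ContractingWith (Real.toNNReal √(1 - τ * μ)) fun x => x - τ • F x := by
    refine ⟨?_, LipschitzWith.of_dist_le_mul fun x y => ?_⟩
    · rw [Real.toNNReal_lt_one, Real.sqrt_lt' one_pos]
      linarith [mul_pos hτpos hμ]
    · rw [Real.coe_toNNReal _ (Real.sqrt_nonneg _), dist_eq_norm, dist_eq_norm]
      refine le_of_sq_le_sq ?_ (by positivity)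
      rw [mul_pow, Real.sq_sqrt (sub_nonneg.2 hτμ)]
      exact (norm_sub_smul_sub_sq_le hmono hlip hτpos.le x y).trans (by gcongr)
  obtain ⟨x, hx⟩ : ∃ x, x - τ • F x = x := ⟨_, hcontr.fixedPoint_isFixedPt⟩
  exact ⟨x, (smul_eq_zero.1 (sub_eq_self.1 hx)).resolve_left hτpos.ne'⟩

end StronglyMonotone

section Quantizer

theorem supBound_of_norm_le {x : Profile d} {b : ℝ} (h : ‖x‖ ≤ b) : SupBound x b := fun i c =>
  ((PiLp.norm_apply_le (x i) c).trans (PiLp.norm_apply_le x i)).trans h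

theorem norm_sq_le_of_supBound {x : Profile d} {b : ℝ} (h : SupBound x b) :
    ‖x‖ ^ 2 ≤ (∑ i, d i : ℕ) * b ^ 2 := by
  have hblock (i : Fin N) : ‖x i‖ ^ 2 ≤ d i * b ^ 2 := by
    rw [EuclideanSpace.norm_sq_eq]
    simpa using Finset.sum_le_sum fun c (_ : c ∈ Finset.univ) => sq_le_sq' (abs_le.1 (h i c)).1
      (abs_le.1 (h i c)).2
  rw [PiLp.norm_sq_eq_of_L2, Nat.cast_sum, Finset.sum_mul]
  exact Finset.sum_le_sum fun i _ => hblock i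

theorem norm_le_of_supBound {v : Stack d} {b : ℝ} (hb : 0 ≤ b) (h : ∀ i, SupBound (v i) b) :
    ‖v‖ ≤ √(N * (∑ i, d i : ℕ)) * b := by
  refine le_of_sq_le_sq ?_ (by positivity)
  rw [PiLp.norm_sq_eq_of_L2, mul_pow, Real.sq_sqrt (by positivity), mul_assoc]
  simpa using Finset.sum_le_sum fun i (_ : i ∈ Finset.univ) => norm_sq_le_of_supBound (h i)

theorem abs_sub_quantize_le {L : ℕ} {x : ℝ} (hx : |x| ≤ L + 1 / 2) :
    |x - quantize L x| ≤ 1 / 2 := by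
  have hround (z : ℝ) (hzL : z ≤ L + 1 / 2) :
      |z - ((min (L : ℤ) ⌊z + 1 / 2⌋ : ℤ) : ℝ)| ≤ 1 / 2 := by
    have hfloor := Int.floor_le (z + 1 / 2)
    have hlt := Int.lt_floor_add_one (z + 1 / 2)
    rcases le_total (L : ℤ) ⌊z + 1 / 2⌋ with h | h
    · have hL : (L : ℝ) ≤ ⌊z + 1 / 2⌋ := by exact_mod_cast h
      rw [min_eq_left h, abs_le]
      constructor <;> push_cast <;> linarith
    · rw [min_eq_right h, abs_le]
      constructor <;> linarith
  rw [abs_le] at hx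
  unfold quantize
  split_ifs with h
  · have hneg := hround (-x) (by linarith [hx.1])
    rw [abs_le] at hneg ⊢
    push_cast at hneg ⊢
    constructor <;> linarith [hneg.1, hneg.2]
  · exact hround x hx.2

theorem supBound_sub_smul_quantizeVec {L : ℕ} {s : ℝ} (hs : 0 < s) {x : Profile d}
    (hx : SupBound x (s * (L + 1 / 2))) :
    SupBound (x - s • quantizeVec L (s⁻¹ • x)) (s / 2) := by
  intro i c
  have hscale : (x - s • quantizeVec L (s⁻¹ • x)) i c =
      s * (s⁻¹ * x i c - quantize L (s⁻¹ * x i c)) := by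
    simp [quantizeVec, mul_sub, hs.ne']
  have hrange : |s⁻¹ * x i c| ≤ L + 1 / 2 := by
    rw [abs_mul, abs_of_pos (inv_pos.2 hs), inv_mul_le_iff₀ hs]
    exact hx i c
  rw [hscale, abs_mul, abs_of_pos hs]
  linarith [mul_le_mul_of_nonneg_left (abs_sub_quantize_le hrange) hs.le]

end Quantizer

theorem ascEig_eq_eigenvalues {m : ℕ} {A : Matrix (Fin m) (Fin m) ℝ} (hA : A.IsHermitian)
    (k : Fin m) : ascEig hA k = hA.eigenvalues (Fintype.equivOfCardEq (Fintype.card_fin _)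
      (Fin.cast (Fintype.card_fin m).symm k.rev)) := by
  simp [ascEig, Matrix.IsHermitian.eigenvalues]

theorem ascEig_mono {m : ℕ} {A : Matrix (Fin m) (Fin m) ℝ} (hA : A.IsHermitian) :
    Monotone (ascEig hA) := fun i j hij =>
  hA.eigenvalues₀_antitone (by simpa using Fin.rev_le_rev.2 hij)

theorem ascEig_pos {m : ℕ} {A : Matrix (Fin m) (Fin m) ℝ} (hA : A.PosDef) (k : Fin m) :
    0 < ascEig hA.isHermitian k := by
  rw [ascEig_eq_eigenvalues]
  exact hA.eigenvalues_pos _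

theorem posDef_of_sq_lt_mul {a b c : ℝ} (ha : 0 < a) (h : b ^ 2 < a * c) :
    (!![a, b; b, c] : Matrix (Fin 2) (Fin 2) ℝ).PosDef := by
  refine Matrix.PosDef.of_dotProduct_mulVec_pos ?_ fun x hx => ?_
  · ext i j
    fin_cases i <;> fin_cases j <;> simp
  · have hquad : star x ⬝ᵥ (!![a, b; b, c] : Matrix (Fin 2) (Fin 2) ℝ).mulVec x =
        a⁻¹ * ((a * x 0 + b * x 1) ^ 2 + (a * c - b ^ 2) * x 1 ^ 2) := by
      simp only [star_trivial, dotProduct, Matrix.mulVec, Fin.sum_univ_two, Matrix.of_apply,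
        Matrix.cons_val_zero, Matrix.cons_val_one, Matrix.cons_val_fin_one]
      field_simp
      ring
    rw [hquad]
    have : 0 < a * c - b ^ 2 := sub_pos.2 h
    by_cases h1 : x 1 = 0
    · have h0 : x 0 ≠ 0 := fun h0 => hx (by ext i; fin_cases i <;> simp [h0, h1])
      simp only [h1, mul_zero, add_zero, zero_pow two_ne_zero]
      positivity
    · positivity

namespace CommGraph

variable (W : CommGraph N)

theorem weight_nonneg (i j : Fin N) : 0 ≤ W.weight i j := by
  by_cases h : W.graph.Adj i j
  · exact (W.pos i j h).le
  · exact (W.zero i j h).ge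

/-- The Dirichlet energy of a function on the vertices; the sum runs over ordered pairs, so that
every edge counts twice. -/
def energy {E : Type*} [NormedAddCommGroup E] (v : Fin N → E) : ℝ :=
  ∑ i, ∑ j, W.weight i j * ‖v i - v j‖ ^ 2

section Poincare

variable {E : Type*} [NormedAddCommGroup E]

theorem energy_nonneg (v : Fin N → E) : 0 ≤ W.energy v :=
  Finset.sum_nonneg fun i _ => Finset.sum_nonneg fun j _ =>
    mul_nonneg (W.weight_nonneg i j) (by positivity)

theorem weight_mul_norm_sub_sq_le_energy (v : Fin N → E) (i j : Fin N) :
    W.weight i j * ‖v i - v j‖ ^ 2 ≤ W.energy v := by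
  have hterm (i j : Fin N) : 0 ≤ W.weight i j * ‖v i - v j‖ ^ 2 :=
    mul_nonneg (W.weight_nonneg i j) (by positivity)
  calc W.weight i j * ‖v i - v j‖ ^ 2 ≤ ∑ j, W.weight i j * ‖v i - v j‖ ^ 2 :=
        Finset.single_le_sum (fun j _ => hterm i j) (Finset.mem_univ j)
    _ ≤ W.energy v := Finset.single_le_sum
        (f := fun i => ∑ j, W.weight i j * ‖v i - v j‖ ^ 2)
        (fun i _ => Finset.sum_nonneg fun j _ => hterm i j) (Finset.mem_univ i)

theorem exists_norm_sub_sq_le_of_reachable {i j : Fin N} (h : W.graph.Reachable i j) :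
    ∃ C : ℝ, 0 ≤ C ∧ ∀ v : Fin N → E, ‖v i - v j‖ ^ 2 ≤ C * W.energy v := by
  obtain ⟨p⟩ := h
  induction p with
  | nil => exact ⟨0, le_rfl, fun v => by simp⟩
  | @cons i k j hik _ ih =>
    obtain ⟨C, hC, ih⟩ := ih
    have hpos := W.pos i k hik
    refine ⟨2 * ((W.weight i k)⁻¹ + C), by positivity, fun v => ?_⟩
    have hedge : ‖v i - v k‖ ^ 2 ≤ (W.weight i k)⁻¹ * W.energy v := by
      rw [le_inv_mul_iff₀ hpos]
      exact W.weight_mul_norm_sub_sq_le_energy v i k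
    calc ‖v i - v j‖ ^ 2 ≤ (‖v i - v k‖ + ‖v k - v j‖) ^ 2 := by
          gcongr
          exact norm_sub_le_norm_sub_add_norm_sub _ _ _
      _ ≤ 2 * (‖v i - v k‖ ^ 2 + ‖v k - v j‖ ^ 2) := add_sq_le
      _ ≤ 2 * ((W.weight i k)⁻¹ * W.energy v + C * W.energy v) := by
          gcongr
          exact ih v
      _ = _ := by ring

theorem exists_sum_norm_sub_sq_le (hW : W.graph.Connected) (i₀ : Fin N) :
    ∃ C : ℝ, 0 < C ∧ ∀ v : Fin N → E, ∑ i, ‖v i - v i₀‖ ^ 2 ≤ C * W.energy v := by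
  choose C hC hle using fun i =>
    W.exists_norm_sub_sq_le_of_reachable (E := E) (hW.preconnected i i₀)
  have hsum : 0 ≤ ∑ i, C i := Finset.sum_nonneg fun i _ => hC i
  refine ⟨∑ i, C i + 1, by positivity, fun v => ?_⟩
  calc ∑ i, ‖v i - v i₀‖ ^ 2 ≤ ∑ i, C i * W.energy v := Finset.sum_le_sum fun i _ => hle i v
    _ = (∑ i, C i) * W.energy v := (Finset.sum_mul ..).symm
    _ ≤ (∑ i, C i + 1) * W.energy v := by
        gcongr
        · exact W.energy_nonneg v
        · linarith

end Poincare

theorem sum_weight_inner_eq_energy {E : Type*} [NormedAddCommGroup E] [InnerProductSpace ℝ E]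
    (v : Fin N → E) :
    ∑ i, ∑ j, W.weight i j * inner ℝ (v i) (v i - v j) = W.energy v / 2 := by
  have hswap : ∑ i, ∑ j, W.weight i j * inner ℝ (v i) (v i - v j) =
      ∑ i, ∑ j, W.weight i j * inner ℝ (v j) (v j - v i) := by
    rw [Finset.sum_comm]
    simp_rw [W.symm]
  have hsum : W.energy v = ∑ i, ∑ j, W.weight i j * inner ℝ (v i) (v i - v j) +
      ∑ i, ∑ j, W.weight i j * inner ℝ (v j) (v j - v i) := by
    simp only [energy, ← Finset.sum_add_distrib, ← mul_add, ← real_inner_self_eq_norm_sq,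
      inner_sub_left, inner_sub_right]
    congr! 3
    ring
  linarith

theorem laplacian_mulVec_apply (v : Fin N → ℝ) (i : Fin N) :
    W.laplacian.mulVec v i = ∑ j, W.weight i j * (v i - v j) := by
  simp only [Matrix.mulVec, dotProduct]
  rw [← Finset.add_sum_erase _ _ (Finset.mem_univ i), ← Finset.add_sum_erase _ _
    (Finset.mem_univ i), sub_self, mul_zero, zero_add]
  simp only [laplacian, Matrix.of_apply, if_true, Finset.sum_mul, ← Finset.sum_add_distrib]
  refine Finset.sum_congr rfl fun j hj => ?_
  rw [if_neg (Finset.ne_of_mem_erase hj).symm]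
  ring

theorem dotProduct_laplacian_mulVec (v : Fin N → ℝ) :
    v ⬝ᵥ (W.laplacian.mulVec v) = W.energy v / 2 := by
  simp only [← W.sum_weight_inner_eq_energy, dotProduct, laplacian_mulVec_apply, Finset.mul_sum,
    RCLike.inner_apply, conj_trivial]
  congr! 2
  ring

theorem eq_of_mulVec_eq_smul (hW : W.graph.Connected) {v : Fin N → ℝ} {l : ℝ} (hl : l ≤ 0)
    (hv : W.laplacian.mulVec v = l • v) (i j : Fin N) : v i = v j := by
  have henergy : W.energy v / 2 = l * (v ⬝ᵥ v) := by
    rw [← W.dotProduct_laplacian_mulVec, hv, dotProduct_smul, smul_eq_mul]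
  have hvv : 0 ≤ v ⬝ᵥ v := Finset.sum_nonneg fun i _ => mul_self_nonneg _
  have hzero : W.energy v = 0 :=
    le_antisymm (by linarith [mul_nonpos_of_nonpos_of_nonneg hl hvv]) (W.energy_nonneg v)
  obtain ⟨C, -, hle⟩ := W.exists_norm_sub_sq_le_of_reachable (E := ℝ) (hW.preconnected i j)
  have hsq : ‖v i - v j‖ ^ 2 ≤ 0 := by simpa [hzero] using hle v
  exact sub_eq_zero.1 (norm_eq_zero.1 (pow_eq_zero_iff two_ne_zero |>.1
    (hsq.antisymm (sq_nonneg _))))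

theorem eq_of_eigenvalues_nonpos (hW : W.graph.Connected) {a b : Fin N}
    (ha : W.laplacian_isHermitian.eigenvalues a ≤ 0)
    (hb : W.laplacian_isHermitian.eigenvalues b ≤ 0) : a = b := by
  set u := W.laplacian_isHermitian.eigenvectorBasis
  have hconst {c : Fin N} (hc : W.laplacian_isHermitian.eigenvalues c ≤ 0) (i : Fin N) :
      u c i = u c a :=
    W.eq_of_mulVec_eq_smul hW hc (W.laplacian_isHermitian.mulVec_eigenvectorBasis c) i a
  by_contra hne
  have hpar : u b a • u a = u a a • u b := by
    ext i
    simp only [PiLp.smul_apply, smul_eq_mul, hconst ha i, hconst hb i, mul_comm]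
  have hba : u b a = 0 := by
    simpa [inner_smul_right, u.orthonormal.2 hne, u.orthonormal.1 a] using
      congrArg (inner ℝ (u a)) hpar
  exact u.orthonormal.ne_zero b (by ext i; rw [hconst hb i, hba]; rfl)

theorem lam2_pos (hN : 2 ≤ N) (hW : W.graph.Connected) : 0 < W.lam2 hN := by
  by_contra! hneg
  have h1 : ascEig W.laplacian_isHermitian ⟨1, by omega⟩ ≤ 0 := hneg
  have h0 : ascEig W.laplacian_isHermitian ⟨0, by omega⟩ ≤ 0 :=
    (ascEig_mono _ (by simp [Fin.le_def])).trans h1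
  rw [ascEig_eq_eigenvalues] at h0 h1
  have heq := W.eq_of_eigenvalues_nonpos hW h0 h1
  simp only [EmbeddingLike.apply_eq_iff_eq, Fin.cast_inj, Fin.rev_inj, Fin.mk.injEq,
    zero_ne_one] at heq

theorem lamN_pos (hN : 2 ≤ N) (hW : W.graph.Connected) : 0 < W.lamN hN :=
  (W.lam2_pos hN hW).trans_le (ascEig_mono _ (Fin.le_def.2 (show 1 ≤ N - 1 by omega)))

/-- The Laplacian acting blockwise on stacked estimates, `L ⊗ I`. -/
def lap (d : Fin N → ℕ) : Stack d →L[ℝ] Stack d :=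
  let proj (i : Fin N) : Stack d →L[ℝ] Profile d := PiLp.proj 2 (fun _ => Profile d) i
  (PiLp.continuousLinearEquiv 2 ℝ fun _ : Fin N => Profile d).symm.toContinuousLinearMap ∘L
    ContinuousLinearMap.pi fun i => ∑ j, W.weight i j • (proj i - proj j)

theorem lap_apply (v : Stack d) (i : Fin N) :
    W.lap d v i = ∑ j, W.weight i j • (v i - v j) := by
  simp [lap]

theorem inner_lap (v : Stack d) : inner ℝ v (W.lap d v) = W.energy (fun i => v i) / 2 := by
  rw [← W.sum_weight_inner_eq_energy, PiLp.inner_apply]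
  simp only [lap_apply, inner_sum, real_inner_smul_right]

end CommGraph

/-- The consensus state `1_N ⊗ x`, in which all players hold the same estimate `x`. -/
def consensus (x : Profile d) : Stack d :=
  WithLp.toLp 2 fun _ => x

theorem consensus_apply (x : Profile d) (i : Fin N) : consensus x i = x := rfl

theorem norm_consensus_sq (x : Profile d) : ‖consensus x‖ ^ 2 = N * ‖x‖ ^ 2 := by
  simp [PiLp.norm_sq_eq_of_L2, consensus_apply]

namespace CommGraph

variable (W : CommGraph N)

theorem lap_consensus (x : Profile d) : W.lap d (consensus x) = 0 := by
  ext1 i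
  simp [lap_apply, consensus_apply]

theorem exists_norm_sub_consensus_sq_le (hW : W.graph.Connected) (i₀ : Fin N) :
    ∃ P : ℝ, 0 < P ∧ ∀ v : Stack d,
      ‖v - consensus (v i₀)‖ ^ 2 ≤ P * inner ℝ v (W.lap d v) := by
  obtain ⟨C, hC, hle⟩ := W.exists_sum_norm_sub_sq_le (E := Profile d) hW i₀
  refine ⟨2 * C, by positivity, fun v => ?_⟩
  rw [inner_lap, PiLp.norm_sq_eq_of_L2]
  exact (hle fun i => v i).trans_eq (by ring)

end CommGraph

section Game

theorem replaceAction_self (x : Profile d) (i : Fin N) : replaceAction x i (x i) = x := by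
  ext1 j
  simp [replaceAction]

theorem replaceAction_apply_same (x : Profile d) (i : Fin N) (z : EuclideanSpace ℝ (Fin (d i))) :
    replaceAction x i z i = z := by
  simp [replaceAction]

theorem replaceAction_apply_of_ne (x : Profile d) {i j : Fin N} (h : j ≠ i)
    (z : EuclideanSpace ℝ (Fin (d i))) : replaceAction x i z j = x j := by
  simp [replaceAction, h]

theorem norm_sub_sq_eq_add_norm_replaceAction_sub_sq (x y : Profile d) (i : Fin N) :
    ‖x - y‖ ^ 2 = ‖x i - y i‖ ^ 2 + ‖replaceAction x i (y i) - y‖ ^ 2 := by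
  rw [PiLp.norm_sq_eq_of_L2, PiLp.norm_sq_eq_of_L2 _ (replaceAction x i (y i) - y),
    ← Finset.add_sum_erase _ _ (Finset.mem_univ i),
    ← Finset.add_sum_erase _ (fun j => ‖(replaceAction x i (y i) - y) j‖ ^ 2)
      (Finset.mem_univ i)]
  simp only [PiLp.sub_apply, replaceAction_apply_same, sub_self, norm_zero,
    zero_pow two_ne_zero, zero_add]
  congr 1
  refine Finset.sum_congr rfl fun j hj => ?_
  rw [replaceAction_apply_of_ne x (Finset.ne_of_mem_erase hj)]

theorem le_of_convexOn_of_gradient_eq_zero {E : Type*} [NormedAddCommGroup E]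
    [InnerProductSpace ℝ E] [CompleteSpace E] {f : E → ℝ} (hf : ConvexOn ℝ Set.univ f) {x : E}
    (hd : DifferentiableAt ℝ f x) (h0 : gradient f x = 0) (z : E) : f x ≤ f z := by
  have hline : HasDerivAt (f ∘ AffineMap.lineMap (k := ℝ) x z) 0 0 := by
    have hfx : HasFDerivAt f (0 : E →L[ℝ] ℝ) (AffineMap.lineMap (k := ℝ) x z 0) := by
      simpa [h0] using hd.hasGradientAt.hasFDerivAt
    simpa using hfx.comp_hasDerivAt (0 : ℝ) AffineMap.hasDerivAt_lineMap
  have hconvex : ConvexOn ℝ Set.univ (f ∘ AffineMap.lineMap (k := ℝ) x z) := by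
    simpa using hf.comp_affineMap (AffineMap.lineMap (k := ℝ) x z)
  simpa [slope_def_field] using
    hconvex.le_slope_of_hasDerivAt (Set.mem_univ 0) (Set.mem_univ 1) one_pos hline

variable {J : Fin N → Profile d → ℝ}

theorem isNash_of_gameMap_eq_zero {x : Profile d}
    (hconvex : ∀ i, ConvexOn ℝ Set.univ fun z => J i (replaceAction x i z))
    (hdiff : ∀ i, DifferentiableAt ℝ (fun z => J i (replaceAction x i z)) (x i))
    (hx : gameMap J x = 0) : IsNash J x := by
  intro i z
  have h0 : ownGrad J i x = 0 := congrArg (fun w : Profile d => w i) hx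
  simpa only [replaceAction_self] using
    le_of_convexOn_of_gradient_eq_zero (hconvex i) (hdiff i) h0 z

/-- The stacked gradients `R_i ∇_i J_i(𝒙^i)`, without the factor `ε`. -/
def gradStack (J : Fin N → Profile d → ℝ) (v : Stack d) : Stack d :=
  WithLp.toLp 2 fun i => WithLp.toLp 2 (Pi.single i (ownGrad J i (v i)))

theorem gradStack_apply_same (v : Stack d) (i : Fin N) :
    gradStack J v i i = ownGrad J i (v i) := by
  simp [gradStack]

theorem gradStack_apply_of_ne (v : Stack d) {i j : Fin N} (h : j ≠ i) :
    gradStack J v i j = 0 := by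
  simp [gradStack, h]

theorem norm_gradStack_sub_sq (v w : Stack d) :
    ‖gradStack J v - gradStack J w‖ ^ 2 =
      ∑ i, ‖ownGrad J i (v i) - ownGrad J i (w i)‖ ^ 2 := by
  rw [PiLp.norm_sq_eq_of_L2]
  refine Finset.sum_congr rfl fun i _ => ?_
  rw [PiLp.norm_sq_eq_of_L2, Finset.sum_eq_single i (fun j _ hj => ?_) (by simp)]
  · simp only [PiLp.sub_apply, gradStack_apply_same]
  · simp [gradStack_apply_of_ne _ hj]

theorem inner_gradStack (y v : Stack d) :
    inner ℝ y (gradStack J v) = ∑ i, inner ℝ (y i i) (ownGrad J i (v i)) := by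
  rw [PiLp.inner_apply]
  refine Finset.sum_congr rfl fun i _ => ?_
  rw [PiLp.inner_apply, Finset.sum_eq_single i (fun j _ hj => ?_) (by simp), gradStack_apply_same]
  rw [gradStack_apply_of_ne _ hj, inner_zero_right]

theorem norm_gameMap_sub (x y : Profile d) :
    ‖gameMap J x - gameMap J y‖ =
      ‖gradStack J (consensus x) - gradStack J (consensus y)‖ := by
  rw [← pow_left_inj₀ (norm_nonneg _) (norm_nonneg _) two_ne_zero, norm_gradStack_sub_sq,
    PiLp.norm_sq_eq_of_L2]
  rfl

theorem inner_consensus_gradStack_consensus (z x : Profile d) :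
    inner ℝ (consensus z) (gradStack J (consensus x)) = inner ℝ z (gameMap J x) := by
  rw [inner_gradStack, PiLp.inner_apply]
  rfl

theorem gradStack_consensus_eq_zero {x : Profile d} (hx : gameMap J x = 0) :
    gradStack J (consensus x) = 0 := by
  have h0 (i : Fin N) : ownGrad J i x = 0 := congrArg (fun w : Profile d => w i) hx
  ext1 i
  simp [gradStack, consensus_apply, h0]

end Game

theorem theta_nonneg (θown θother : Fin N → ℝ) : 0 ≤ theta θown θother :=
  Real.iSup_nonneg fun _ => Real.sqrt_nonneg _

theorem mul_norm_sq_le_inner_add_of_lipschitzWith {H : Type*} [NormedAddCommGroup H]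
    [InnerProductSpace ℝ H] {G : H → H} {Θ : ℝ≥0} (hG : LipschitzWith Θ G) (hG0 : G 0 = 0)
    {m : ℝ} (hm : 0 < m) {w : H} (hw : m * ‖w‖ ^ 2 ≤ inner ℝ w (G w)) (y : H) :
    m / 4 * ‖y‖ ^ 2 ≤ inner ℝ y (G y) + (2 * Θ ^ 2 / m + Θ + m / 2) * ‖y - w‖ ^ 2 := by
  have htri : ‖y‖ ≤ ‖w‖ + ‖y - w‖ := norm_le_norm_add_norm_sub' y w
  have hdiff : -(‖w‖ * (Θ * ‖y - w‖)) ≤ inner ℝ w (G y - G w) :=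
    (neg_le_neg (by gcongr; exact hG.norm_sub_le y w)).trans
      (neg_le_of_abs_le (abs_real_inner_le_norm _ _))
  have hrest : -(‖y - w‖ * (Θ * (‖w‖ + ‖y - w‖))) ≤ inner ℝ (y - w) (G y) := by
    have hGy : ‖G y‖ ≤ Θ * ‖y‖ := by simpa [hG0] using hG.norm_sub_le y 0
    exact (neg_le_neg (by gcongr; exact hGy.trans (by gcongr))).trans
      (neg_le_of_abs_le (abs_real_inner_le_norm _ _))
  have hsplit : inner ℝ y (G y) =
      inner ℝ w (G w) + inner ℝ w (G y - G w) + inner ℝ (y - w) (G y) := by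
    rw [inner_sub_right, inner_sub_left]
    ring
  have hyoung : 2 * Θ * (‖w‖ * ‖y - w‖) ≤ m / 2 * ‖w‖ ^ 2 + 2 * Θ ^ 2 / m * ‖y - w‖ ^ 2 := by
    have hsq : m / 2 * ‖w‖ ^ 2 + 2 * Θ ^ 2 / m * ‖y - w‖ ^ 2 - 2 * Θ * (‖w‖ * ‖y - w‖) =
        m / 2 * (‖w‖ - 2 * Θ / m * ‖y - w‖) ^ 2 := by
      field_simp
      ring
    rw [← sub_nonneg, hsq]
    positivity
  have hnorm : m / 4 * ‖y‖ ^ 2 ≤ m / 4 * (2 * (‖w‖ ^ 2 + ‖y - w‖ ^ 2)) := by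
    gcongr
    exact (pow_le_pow_left₀ (norm_nonneg y) htri 2).trans add_sq_le
  linarith

namespace MonotoneLipschitz

variable {J : Fin N → Profile d → ℝ} {μ : ℝ} {θown θother : Fin N → ℝ}

theorem norm_ownGrad_sub_le (hF : MonotoneLipschitz J μ θown θother) (i : Fin N)
    (x y : Profile d) :
    ‖ownGrad J i x - ownGrad J i y‖ ≤ theta θown θother * ‖x - y‖ := by
  set m := replaceAction x i (y i) with hm
  have hown : ‖ownGrad J i x - ownGrad J i m‖ ≤ θown i * ‖x i - y i‖ := by
    simpa only [hm, replaceAction_apply_same] using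
      hF.lip_own i x m fun j hj => (replaceAction_apply_of_ne x hj _).symm
  have hother : ‖ownGrad J i m - ownGrad J i y‖ ≤ θother i * ‖m - y‖ :=
    hF.lip_other i m y (replaceAction_apply_same x i _)
  have hθ : √(θown i ^ 2 + θother i ^ 2) ≤ theta θown θother :=
    le_ciSup (f := fun i => √(θown i ^ 2 + θother i ^ 2)) (Set.finite_range _).bddAbove i
  calc ‖ownGrad J i x - ownGrad J i y‖
      ≤ ‖ownGrad J i x - ownGrad J i m‖ + ‖ownGrad J i m - ownGrad J i y‖ :=
        norm_sub_le_norm_sub_add_norm_sub _ _ _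
    _ ≤ θown i * ‖x i - y i‖ + θother i * ‖m - y‖ := add_le_add hown hother
    _ ≤ √(θown i ^ 2 + θother i ^ 2) * ‖x - y‖ := by
      refine le_of_sq_le_sq ?_ (by positivity)
      rw [mul_pow, Real.sq_sqrt (by positivity),
        norm_sub_sq_eq_add_norm_replaceAction_sub_sq x y i, ← hm]
      nlinarith [sq_nonneg (θown i * ‖m - y‖ - θother i * ‖x i - y i‖)]
    _ ≤ theta θown θother * ‖x - y‖ := by gcongr

theorem lipschitzWith_gradStack (hF : MonotoneLipschitz J μ θown θother) :
    LipschitzWith (theta θown θother).toNNReal (gradStack J) := by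
  refine LipschitzWith.of_dist_le_mul fun v w => ?_
  rw [Real.coe_toNNReal _ (theta_nonneg _ _), dist_eq_norm, dist_eq_norm]
  refine le_of_sq_le_sq ?_ (mul_nonneg (theta_nonneg _ _) (norm_nonneg _))
  rw [norm_gradStack_sub_sq, mul_pow, PiLp.norm_sq_eq_of_L2 _ (v - w), Finset.mul_sum]
  refine Finset.sum_le_sum fun i _ => ?_
  rw [← mul_pow]
  exact pow_le_pow_left₀ (norm_nonneg _) (hF.norm_ownGrad_sub_le i _ _) 2

theorem lipschitzWith_gradStack_add (hF : MonotoneLipschitz J μ θown θother) (w : Stack d) :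
    LipschitzWith (theta θown θother).toNNReal fun v => gradStack J (w + v) := by
  simpa [Function.comp_def] using
    hF.lipschitzWith_gradStack.comp (isometry_add_left w).lipschitz

theorem exists_gameMap_eq_zero (hF : MonotoneLipschitz J μ θown θother) :
    ∃ x, gameMap J x = 0 := by
  refine exists_eq_zero_of_strongly_monotone hF.mu_pos hF.strongMono
    (K := (theta θown θother).toNNReal * NNReal.sqrt N)
    (LipschitzWith.of_dist_le_mul fun x y => ?_)
  have hcons : ‖consensus x - consensus y‖ = √N * ‖x - y‖ := by
    rw [← pow_left_inj₀ (norm_nonneg _) (by positivity) two_ne_zero, mul_pow,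
      Real.sq_sqrt N.cast_nonneg, ← norm_consensus_sq]
    rfl
  rw [dist_eq_norm, dist_eq_norm, norm_gameMap_sub, NNReal.coe_mul, Real.coe_sqrt,
    NNReal.coe_natCast, mul_assoc, ← hcons]
  exact hF.lipschitzWith_gradStack.norm_sub_le _ _

theorem exists_coercive_gain (hF : MonotoneLipschitz J μ θown θother) {W : CommGraph N}
    (hW : W.graph.Connected) (i₀ : Fin N) :
    ∃ κ₀ : ℝ, ∀ κ, κ₀ ≤ κ → ∀ x, gameMap J x = 0 → ∀ y : Stack d,
      μ / (4 * N) * ‖y‖ ^ 2 ≤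
        κ * inner ℝ y (W.lap d y) + inner ℝ y (gradStack J (consensus x + y)) := by
  have hN : (0 : ℝ) < N := mod_cast i₀.pos
  have hμ := hF.mu_pos
  obtain ⟨P, hP, hpoincare⟩ := W.exists_norm_sub_consensus_sq_le (d := d) hW i₀
  set Θ := (theta θown θother).toNNReal
  set K : ℝ := 2 * Θ ^ 2 / (μ / N) + Θ + μ / N / 2
  refine ⟨K * P, fun κ hκ x hx y => ?_⟩
  have hG0 : gradStack J (consensus x + 0) = 0 := by
    rw [add_zero, gradStack_consensus_eq_zero hx]
  have hcoercive : μ / N * ‖consensus (y i₀)‖ ^ 2 ≤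
      inner ℝ (consensus (y i₀)) (gradStack J (consensus x + consensus (y i₀))) := by
    have hmono := hF.strongMono (x + y i₀) x
    rw [hx, sub_zero, add_sub_cancel_left, real_inner_comm,
      ← inner_consensus_gradStack_consensus] at hmono
    rw [norm_consensus_sq, ← mul_assoc, div_mul_cancel₀ μ hN.ne']
    exact hmono
  have hlap : 0 ≤ inner ℝ y (W.lap d y) :=
    nonneg_of_mul_nonneg_right ((sq_nonneg _).trans (hpoincare y)) hP
  calc μ / (4 * N) * ‖y‖ ^ 2 = μ / N / 4 * ‖y‖ ^ 2 := by rw [div_div, mul_comm (4 : ℝ)]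
    _ ≤ inner ℝ y (gradStack J (consensus x + y)) + K * ‖y - consensus (y i₀)‖ ^ 2 :=
        mul_norm_sq_le_inner_add_of_lipschitzWith (hF.lipschitzWith_gradStack_add _) hG0
          (by positivity) hcoercive y
    _ ≤ inner ℝ y (gradStack J (consensus x + y)) + K * (P * inner ℝ y (W.lap d y)) := by
        gcongr
        exact hpoincare y
    _ ≤ inner ℝ y (gradStack J (consensus x + y)) + κ * inner ℝ y (W.lap d y) := by
        rw [← mul_assoc]
        gcongr
    _ = _ := add_comm _ _

end MonotoneLipschitz

section SamplingIntervals

variable {T t : ℝ}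

theorem floor_div_eq_of_mem_Ico (hT : 0 < T) {k : ℕ} (ht : t ∈ Set.Ico (k * T) ((k + 1) * T)) :
    ⌊t / T⌋₊ = k := by
  have ht0 : 0 ≤ t := le_trans (by positivity) ht.1
  rw [Nat.floor_eq_iff (by positivity)]
  exact ⟨(le_div_iff₀ hT).2 ht.1, (div_lt_iff₀ hT).2 ht.2⟩

theorem mem_Ico_floor_div (hT : 0 < T) (ht : 0 ≤ t) :
    t ∈ Set.Ico (⌊t / T⌋₊ * T) ((⌊t / T⌋₊ + 1) * T) :=
  ⟨(le_div_iff₀ hT).1 (Nat.floor_le (by positivity)),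
    (div_lt_iff₀ hT).1 (Nat.lt_floor_add_one _)⟩

theorem continuousOn_Ici_of_continuousOn_Icc {X : Type*} [TopologicalSpace X] {x : ℝ → X}
    (hT : 0 < T) (h : ∀ k : ℕ, ContinuousOn x (Set.Icc (k * T) ((k + 1) * T))) :
    ContinuousOn x (Set.Ici 0) := by
  have hall (k : ℕ) : ContinuousOn x (Set.Icc 0 (k * T)) := by
    induction k with
    | zero => simp
    | succ k ih =>
      have hunion := ih.union_of_isClosed (h k) isClosed_Icc isClosed_Icc
      rw [Set.Icc_union_Icc_eq_Icc (by positivity) (by gcongr; simp)] at hunion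
      rwa [Nat.cast_succ]
  intro t ht
  obtain ⟨k, hk⟩ := exists_nat_gt (t / T)
  have htk : t < k * T := (div_lt_iff₀ hT).1 hk
  refine (hall k t ⟨ht, htk.le⟩).mono_of_mem_nhdsWithin ?_
  rw [← Set.Ici_inter_Iic]
  exact inter_mem_nhdsWithin _ (Iic_mem_nhds htk)

variable {E : Type*}

/-- The concatenation of the curves `X k`, defined on `[0, T]`, along the intervals
`[kT, (k + 1)T)`. -/
def concatCurve (T : ℝ) (X : ℕ → ℝ → E) (t : ℝ) : E :=
  X ⌊t / T⌋₊ (t - ⌊t / T⌋₊ * T)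

theorem concatCurve_of_mem_Ico (hT : 0 < T) (X : ℕ → ℝ → E) {k : ℕ}
    (ht : t ∈ Set.Ico (k * T) ((k + 1) * T)) : concatCurve T X t = X k (t - k * T) := by
  rw [concatCurve, floor_div_eq_of_mem_Ico hT ht]

theorem concatCurve_natCast_mul (hT : 0 < T) (X : ℕ → ℝ → E) (k : ℕ) :
    concatCurve T X (k * T) = X k 0 := by
  rw [concatCurve_of_mem_Ico hT X ⟨le_rfl, by linarith⟩, sub_self]

theorem continuousOn_concatCurve [TopologicalSpace E] (hT : 0 < T) {X : ℕ → ℝ → E}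
    (hX : ∀ k, ContinuousOn (X k) (Set.Icc 0 T)) (hglue : ∀ k, X (k + 1) 0 = X k T) :
    ContinuousOn (concatCurve T X) (Set.Ici 0) := by
  refine continuousOn_Ici_of_continuousOn_Icc hT fun k => ?_
  refine ((hX k).comp (f := fun t => t - k * T) (by fun_prop) fun t ht =>
    ⟨by linarith [ht.1], by linarith [ht.2]⟩).congr fun t ht => ?_
  rcases ht.2.lt_or_eq with hlt | rfl
  · exact concatCurve_of_mem_Ico hT X ⟨ht.1, hlt⟩
  · rw [← Nat.cast_succ, concatCurve_natCast_mul hT, hglue, Function.comp_apply, Nat.cast_succ]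
    congr 1
    ring

theorem hasDerivWithinAt_concatCurve [NormedAddCommGroup E] [NormedSpace ℝ E] (hT : 0 < T)
    {X : ℕ → ℝ → E} {v : E} (ht : 0 ≤ t)
    (hX : HasDerivWithinAt (X ⌊t / T⌋₊) v (Set.Icc 0 T) (t - ⌊t / T⌋₊ * T)) :
    HasDerivWithinAt (concatCurve T X) v (Set.Ici t) t := by
  have hmem := mem_Ico_floor_div hT ht
  set k := ⌊t / T⌋₊
  have hshift : HasDerivWithinAt (fun s => X k (s - k * T)) v
      (Set.Ico (k * T) ((k + 1) * T)) t := by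
    refine (hX.scomp t ((hasDerivWithinAt_id t _).sub_const (k * T)) fun s hs => ?_).congr_deriv
      (one_smul _ _)
    simp only [id, Set.mem_Icc]
    exact ⟨by linarith [hs.1], by linarith [hs.2]⟩
  refine (hshift.congr (fun s hs => concatCurve_of_mem_Ico hT X hs)
    (concatCurve_of_mem_Ico hT X hmem)).mono_of_mem_nhdsWithin ?_
  filter_upwards [self_mem_nhdsWithin, mem_nhdsWithin_of_mem_nhds (Iio_mem_nhds hmem.2)] with
    s hts hs
  exact ⟨hmem.1.trans hts, hs⟩

theorem exists_sampledData_solution [NormedAddCommGroup E] [NormedSpace ℝ E] [CompleteSpace E]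
    {f : E → E → E} {K : ℝ≥0} (hf : ∀ w, LipschitzWith K (f w)) (hT : 0 < T) (hK : K * T ≤ 1 / 2)
    (update : ℕ → E → E → E) (z w₀ : E) :
    ∃ (x : ℝ → E) (w : ℕ → E), x 0 = z ∧ w 0 = w₀ ∧
      (∀ k : ℕ, w (k + 1) = update k (w k) (x ((k + 1 : ℕ) * T))) ∧
      ContinuousOn x (Set.Ici 0) ∧
      ∀ t, 0 ≤ t → HasDerivWithinAt x (f (w ⌊t / T⌋₊) (x t)) (Set.Ici t) t := by
  choose flow hflow0 hflow using fun w x₀ =>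
    exists_hasDerivWithinAt_Icc_of_lipschitzWith (hf w) hT.le hK x₀
  let state : ℕ → E × E := fun k => k.rec (z, w₀)
    fun k s => (flow s.2 s.1 T, update k s.2 (flow s.2 s.1 T))
  let X : ℕ → ℝ → E := fun k => flow (state k).2 (state k).1
  have hX0 (k : ℕ) : X k 0 = (state k).1 := hflow0 _ _
  refine ⟨concatCurve T X, fun k => (state k).2, ?_, rfl, fun k => ?_,
    continuousOn_concatCurve hT (fun k t ht => (hflow _ _ t ht).continuousWithinAt)
      fun k => hX0 (k + 1), fun t ht => ?_⟩
  · have h := concatCurve_natCast_mul hT X 0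
    rwa [Nat.cast_zero, zero_mul, hX0] at h
  · rw [concatCurve_natCast_mul hT]
    exact congrArg (update k _) (hX0 (k + 1)).symm
  · have hmem := mem_Ico_floor_div hT ht
    exact hasDerivWithinAt_concatCurve hT ht
      (hflow _ _ _ ⟨by linarith [hmem.1], by linarith [hmem.2]⟩)

end SamplingIntervals

section ClosedLoop

/-- The quantizer of step `s` applied to the estimate of every player. -/
def quantizeStack (L : ℕ) (s : ℝ) (v : Stack d) : Stack d :=
  WithLp.toLp 2 fun i => s • quantizeVec L (s⁻¹ • v i)

theorem norm_quantizeStack_sub_le {L : ℕ} {s : ℝ} (hs : 0 < s) {v : Stack d}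
    (hv : ∀ i, SupBound (v i) (s * (L + 1 / 2))) :
    ‖quantizeStack L s v - v‖ ≤ √(N * (∑ i, d i : ℕ)) * (s / 2) := by
  rw [norm_sub_rev]
  exact norm_le_of_supBound (by positivity) fun i => supBound_sub_smul_quantizeVec hs (hv i)

/-- The stacked decoded values after `k` steps. -/
def decodedStack (c : Consts) (p : Design) (x : ℝ → Stack d) (k : ℕ) : Stack d :=
  WithLp.toLp 2 fun i => decode p.L (scaling c p) (fun m => x (m * p.T) i) k

variable {W : CommGraph N} {J : Fin N → Profile d → ℝ} {c : Consts} {p : Design}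
  {x : ℝ → Stack d}

theorem scaling_eq (c : Consts) (p : Design) (k : ℕ) :
    scaling c p k = s0 c p * Real.exp (-rate c p * (k * p.T)) := by
  rw [scaling, mul_assoc]

theorem decodedStack_zero : decodedStack c p x 0 = quantizeStack p.L (s0 c p) (x 0) := by
  simp [decodedStack, decode, quantizeStack, scaling]

theorem decodedStack_succ (k : ℕ) :
    decodedStack c p x (k + 1) = decodedStack c p x k +
      quantizeStack p.L (scaling c p (k + 1)) (x ((k + 1 : ℕ) * p.T) - decodedStack c p x k) :=
  rfl

theorem norm_decodedStack_succ_sub_le {k : ℕ} (hs : 0 < scaling c p (k + 1))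
    (hrange : ‖decodedStack c p x k - x ((k + 1 : ℕ) * p.T)‖ ≤
      scaling c p (k + 1) * (p.L + 1 / 2)) :
    ‖decodedStack c p x (k + 1) - x ((k + 1 : ℕ) * p.T)‖ ≤
      √(N * (∑ i, d i : ℕ)) * (scaling c p (k + 1) / 2) := by
  rw [norm_sub_rev] at hrange
  rw [decodedStack_succ, add_comm, ← sub_sub_eq_add_sub]
  exact norm_quantizeStack_sub_le hs fun i =>
    supBound_of_norm_le ((PiLp.norm_apply_le _ i).trans hrange)

theorem velocity_eq (t : ℝ) :
    velocity W J c p x t =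
      -(p.α • W.lap d) (decodedStack c p x ⌊t / p.T⌋₊) - p.ε • gradStack J (x t) := by
  ext1 i
  have hcoupling : p.α • ∑ j, W.weight i j • (estimate c p x j t - estimate c p x i t) =
      -(p.α • W.lap d) (decodedStack c p x ⌊t / p.T⌋₊) i := by
    rw [smul_apply, PiLp.smul_apply, W.lap_apply, ← smul_neg, ← Finset.sum_neg_distrib]
    simp only [← smul_neg, neg_sub]
    rfl
  have hgrad : (WithLp.toLp 2 (Pi.single i (p.ε • ownGrad J i (x t i))) : Profile d) =
      (p.ε • gradStack J (x t)) i := by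
    rw [PiLp.smul_apply, gradStack, Pi.single_smul, WithLp.toLp_smul]
  simp only [velocity]
  rw [hcoupling, hgrad]
  rfl

theorem exists_isSolution {K : ℝ≥0} (hJ : LipschitzWith K (gradStack J)) (hε : 0 ≤ p.ε)
    (hT : 0 < p.T) (hK : p.ε * K * p.T ≤ 1 / 2) (z : Stack d) :
    ∃ x, IsSolution W J c p x ∧ x 0 = z := by
  have hf (w : Stack d) : LipschitzWith (p.ε.toNNReal * K)
      fun v => -(p.α • W.lap d) w - p.ε • gradStack J v := by
    refine LipschitzWith.of_dist_le_mul fun u v => ?_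
    rw [dist_sub_left, dist_smul₀, NNReal.coe_mul, Real.coe_toNNReal _ hε, Real.norm_eq_abs,
      abs_of_nonneg hε, mul_assoc]
    gcongr
    exact hJ.dist_le_mul u v
  obtain ⟨x, w, hx0, hw0, hwsucc, hcont, hderiv⟩ := exists_sampledData_solution hf hT
    (by rwa [NNReal.coe_mul, Real.coe_toNNReal _ hε])
    (fun k w v => w + quantizeStack p.L (scaling c p (k + 1)) (v - w)) z
    (quantizeStack p.L (s0 c p) z)
  have hw (k : ℕ) : decodedStack c p x k = w k := by
    induction k with
    | zero => rw [decodedStack_zero, hx0, hw0]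
    | succ k ih => rw [decodedStack_succ, ih, hwsucc]
  refine ⟨x, ⟨hcont, fun t ht => ?_⟩, hx0⟩
  rw [velocity_eq, hw]
  exact hderiv t ht

theorem IsSolution.hasDerivWithinAt_sub_consensus (hx : IsSolution W J c p x) (hT : 0 < p.T)
    (xs : Profile d) {k : ℕ} {t : ℝ} (ht : t ∈ Set.Ico (k * p.T) ((k + 1) * p.T)) :
    HasDerivWithinAt (fun t => x t - consensus xs)
      (-(p.α • W.lap d) (decodedStack c p x k - consensus xs) -
        p.ε • gradStack J (consensus xs + (x t - consensus xs))) (Set.Ici t) t := by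
  have hlap : (p.α • W.lap d) (consensus xs) = 0 := by
    rw [smul_apply, W.lap_consensus, smul_zero]
  have hderiv := hx.2 t (le_trans (by positivity) ht.1)
  rw [velocity_eq, floor_div_eq_of_mem_Ico hT ht] at hderiv
  rw [map_sub, hlap, sub_zero, add_sub_cancel]
  exact hderiv.sub_const _

theorem IsSolution.norm_sub_consensus_le_of_mem_Icc {xs : Profile d} {C Y : ℝ}
    (hx : IsSolution W J c p x) (hγ : 0 < rate c p) (hT : 0 < p.T) (hC : 1 ≤ C)
    (hCT : 32 * C ^ 2 * rate c p * p.T ≤ 1)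
    (hdiss : IsDissipative (p.α • W.lap d) (fun v => p.ε • gradStack J (consensus xs + v))
      (rate c p) C) (hY : 0 < Y) {k : ℕ}
    (hk : ‖x (k * p.T) - consensus xs‖ ≤ Y * Real.exp (-rate c p * (k * p.T)))
    (hdec : ‖decodedStack c p x k - x (k * p.T)‖ ≤
      Y / (16 * C) * Real.exp (-rate c p * (k * p.T)))
    {t : ℝ} (ht : t ∈ Set.Icc (k * p.T) ((k + 1) * p.T)) :
    ‖x t - consensus xs‖ ≤ Y * Real.exp (-rate c p * t) ∧
      ‖decodedStack c p x k - x t‖ ≤ Y / (2 * C) * Real.exp (-rate c p * t) := by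
  have hcont : ContinuousOn (fun t => x t - consensus xs)
      (Set.Icc (k * p.T) ((k + 1) * p.T)) :=
    (hx.1.mono fun t ht => le_trans (by positivity) ht.1).sub continuousOn_const
  have hlen : 32 * C ^ 2 * rate c p * ((k + 1) * p.T - k * p.T) ≤ 1 := by
    rwa [add_mul, one_mul, add_sub_cancel_left]
  have hderiv := fun t ht => hx.hasDerivWithinAt_sub_consensus hT xs (k := k) (t := t) ht
  rw [← sub_sub_sub_cancel_right _ _ (consensus xs)] at hdec
  rw [← sub_sub_sub_cancel_right _ (x t) (consensus xs)]
  exact ⟨hdiss.norm_le_mul_exp hγ hC hlen hcont hderiv hY hk hdec ht,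
    hdiss.norm_held_sub_le hγ hC hlen hcont hderiv hk hdec ht⟩

theorem IsSolution.norm_sub_consensus_le {xs : Profile d} {C Y : ℝ} (hx : IsSolution W J c p x)
    (hγ : 0 < rate c p) (hT : 0 < p.T) (hs : 0 < s0 c p) (hC : 1 ≤ C)
    (hCT : 32 * C ^ 2 * rate c p * p.T ≤ 1)
    (hdiss : IsDissipative (p.α • W.lap d) (fun v => p.ε • gradStack J (consensus xs + v))
      (rate c p) C)
    (hfine : √(N * (∑ i, d i : ℕ)) * (s0 c p / 2) ≤ Y / (16 * C)) (hY : 0 < Y)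
    (hrange : Y ≤ s0 c p * (p.L + 1 / 2)) (hx0 : ‖x 0 - consensus xs‖ ≤ Y)
    (hsup : ∀ i, SupBound (x 0 i) (s0 c p * (p.L + 1 / 2))) {t : ℝ} (ht : 0 ≤ t) :
    ‖x t - consensus xs‖ ≤ Y * Real.exp (-rate c p * t) := by
  have hsample (k : ℕ) :
      ‖x (k * p.T) - consensus xs‖ ≤ Y * Real.exp (-rate c p * (k * p.T)) ∧
      ‖decodedStack c p x k - x (k * p.T)‖ ≤
        Y / (16 * C) * Real.exp (-rate c p * (k * p.T)) := by
    induction k with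
    | zero =>
      simp only [Nat.cast_zero, zero_mul, mul_zero, Real.exp_zero, mul_one, decodedStack_zero]
      exact ⟨hx0, (norm_quantizeStack_sub_le hs hsup).trans hfine⟩
    | succ k ih =>
      obtain ⟨hnorm, hpred⟩ := hx.norm_sub_consensus_le_of_mem_Icc hγ hT hC hCT hdiss hY ih.1 ih.2
        (t := (k + 1 : ℕ) * p.T) ⟨by gcongr; simp, by simp⟩
      have hscale := scaling_eq c p (k + 1)
      refine ⟨hnorm, (norm_decodedStack_succ_sub_le (by rw [hscale]; positivity)
        (hpred.trans ?_)).trans ?_⟩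
      · rw [hscale, mul_right_comm]
        gcongr
        exact (div_le_self hY.le (by linarith)).trans hrange
      · rw [hscale, mul_div_right_comm, ← mul_assoc]
        gcongr
  exact (hx.norm_sub_consensus_le_of_mem_Icc hγ hT hC hCT hdiss hY (hsample _).1 (hsample _).2
    (Set.Ico_subset_Icc_self (mem_Ico_floor_div hT ht))).1

end ClosedLoop

section Bandwidth

theorem limsup_message_rate {T : ℝ} (hT : 0 < T) (r : ℝ) :
    limsup (fun t : ℝ => 1 / t * ∑ _k ∈ Finset.range (⌊t / T⌋₊ + 1), r) atTop = r / T := by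
  have hfloor : Tendsto (fun t : ℝ => (⌊T⁻¹ * t⌋₊ : ℝ) / t) atTop (𝓝 T⁻¹) :=
    tendsto_nat_floor_mul_div_atTop (by positivity)
  have hrate : Tendsto (fun t : ℝ => ((⌊T⁻¹ * t⌋₊ : ℝ) / t + t⁻¹) * r) atTop (𝓝 (r / T)) := by
    simpa [div_eq_inv_mul] using (hfloor.add tendsto_inv_atTop_zero).mul_const r
  refine (hrate.congr fun t => ?_).limsup_eq
  rw [Finset.sum_const, Finset.card_range, nsmul_eq_mul, inv_mul_eq_div]
  push_cast
  ring

theorem message_bits_nonneg (n L : ℕ) : 0 ≤ (n : ℝ) * Real.logb 2 (2 * (L : ℝ) + 1) :=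
  mul_nonneg n.cast_nonneg (Real.logb_nonneg one_lt_two (by simp))

variable (W : CommGraph N) {c : Consts} {p : Design}

theorem designBandwidth_nonneg (hT : 0 < p.T) : 0 ≤ designBandwidth W c p := by
  refine Real.iSup_nonneg fun e => ?_
  rw [limsup_message_rate hT]
  exact div_nonneg (message_bits_nonneg _ _) hT.le

theorem designBandwidth_le (hT : 0 < p.T) :
    designBandwidth W c p ≤ c.n * Real.logb 2 (2 * (p.L : ℝ) + 1) / p.T :=
  Real.iSup_le (fun _ => (limsup_message_rate hT _).le)
    (div_nonneg (message_bits_nonneg _ _) hT.le)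

end Bandwidth

section DesignFamily

variable {c : Consts} {γ κ : ℝ}

/-- `ν` as a function of the ratio `κ = α / ε`, on which alone it depends. -/
def nuOfRatio (c : Consts) (κ : ℝ) : ℝ :=
  nu c ⟨1, κ, 0, 0, 0, 0, 0⟩

theorem nu_eq_nuOfRatio {p : Design} (hε : p.ε ≠ 0) (hα : p.α = κ * p.ε) :
    nu c p = nuOfRatio c κ := by
  have hmatrix : rateMatrix c p = rateMatrix c ⟨1, κ, 0, 0, 0, 0, 0⟩ := by
    simp only [rateMatrix, div_one]
    rw [hα, mul_right_comm, mul_div_cancel_right₀ _ hε]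
  simp only [nuOfRatio, nu, hmatrix]

theorem rho_eq {p : Design} (hε : p.ε ≠ 0) (hα : p.α = κ * p.ε) :
    rho c p = (c.θ / (κ * c.lamN) + 1) *
      (8 * κ * c.lamN / (nuOfRatio c κ ^ 2 * p.β * √(1 - p.β))) := by
  rw [rho, nu_eq_nuOfRatio hε hα, hα]
  congr 1
  · rw [mul_right_comm, mul_div_mul_right _ _ hε]
  · rw [← mul_assoc 8, mul_right_comm _ p.ε, mul_right_comm _ p.ε, mul_div_mul_right _ _ hε]

theorem nuOfRatio_pos (hN : 0 < c.N) (hμ : 0 < c.μ) (hκ : c.θ ^ 2 / c.μ + c.θ < κ * c.lam2) :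
    0 < nuOfRatio c κ := by
  have hNR : (0 : ℝ) < c.N := mod_cast hN
  refine mul_pos two_pos (ascEig_pos (posDef_of_sq_lt_mul (div_pos hμ hNR) ?_) 0)
  rw [neg_sq, div_pow, Real.sq_sqrt hNR.le, div_mul_eq_mul_div, div_one]
  have hdet : c.θ ^ 2 < c.μ * (κ * c.lam2 - c.θ) := (div_lt_iff₀' hμ).1 (by linarith)
  gcongr

/-- The parameters of a family of designs indexed by the convergence rate: `κ = α / ε`,
`χ = ε / γ`, and `τ` is the common bound of `T` and `γT`. -/
structure DesignFamily where
  κ : ℝ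
  χ : ℝ
  β : ℝ
  a2 : ℝ
  τ : ℝ
  L : ℕ

namespace DesignFamily

/-- The member of rate `γ`. With gains proportional to `γ`, time rescales by `γ`, so that a bound
on `γT` suffices for the loop; the bound on `T` serves the rule for the sampling period. -/
def design (q : DesignFamily) (γ : ℝ) : Design where
  ε := q.χ * γ
  α := q.κ * (q.χ * γ)
  β := q.β
  a1 := 1 / 4
  a2 := q.a2
  T := q.τ / (γ + 1)
  L := q.L

/-- The limit of `s(0) / M₀` as `T → 0`. -/
def step (q : DesignFamily) (c : Consts) : ℝ :=
  q.a2 * nuOfRatio c q.κ * √(1 - q.β) / (q.κ * c.lamN)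

/-- The inequalities, independent of `γ` and `M₀`, which make all members of the family admissible
and convergent. `Λ` bounds the Laplacian and `Cγ` the Lipschitz constants of the closed loop. -/
structure IsUniform (q : DesignFamily) (c : Consts) (Λ C : ℝ) : Prop where
  gain : c.θ ^ 2 / c.μ + c.θ < q.κ * c.lam2
  ratio_pos : 0 < q.κ
  scale_pos : 0 < q.χ
  scale_eq : q.χ * nuOfRatio c q.κ * q.β = 4
  coercivity : 2 ≤ q.χ * (c.μ / (4 * c.N))
  beta_pos : 0 < q.β
  beta_lt : q.β < 1
  a2_pos : 0 < q.a2
  a2_lt : q.a2 < 3 / 4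
  one_le : 1 ≤ C
  held_le : q.χ * q.κ * Λ ≤ C
  current_le : q.χ * c.θ ≤ C
  period_pos : 0 < q.τ
  period_le : 32 * C ^ 2 * q.τ ≤ 1
  period_rho_le : q.τ * rho c (q.design 1) ≤ q.χ
  step_le : q.step c ≤ 1 / (8 * C)
  level_range : 3 * (√(c.N * c.n) + 1) ≤ q.step c * q.L
  level_fine : 3 * √(c.N * c.n) ≤ 2 * q.a2 * q.L

variable {q : DesignFamily}

theorem nu_design (hχ : q.χ ≠ 0) (hγ : γ ≠ 0) : nu c (q.design γ) = nuOfRatio c q.κ :=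
  nu_eq_nuOfRatio (mul_ne_zero hχ hγ) rfl

theorem rho_design (hχ : q.χ ≠ 0) (hγ : γ ≠ 0) :
    rho c (q.design γ) = rho c (q.design 1) := by
  rw [rho_eq (mul_ne_zero hχ hγ) rfl, rho_eq (mul_ne_zero hχ one_ne_zero) rfl]
  rfl

namespace IsUniform

variable {Λ C : ℝ}

theorem nuOfRatio_pos (hq : q.IsUniform c Λ C) : 0 < nuOfRatio c q.κ :=
  pos_of_mul_pos_right (pos_of_mul_pos_left (hq.scale_eq ▸ four_pos) hq.beta_pos.le)
    hq.scale_pos.le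

theorem rate_design (hq : q.IsUniform c Λ C) (hγ : γ ≠ 0) : rate c (q.design γ) = γ := by
  rw [rate, nu_design hq.scale_pos.ne' hγ]
  simp only [design]
  linear_combination γ / 4 * hq.scale_eq

theorem rate_mul_period_le (hq : q.IsUniform c Λ C) (hγ : 0 < γ) : γ * (q.design γ).T ≤ q.τ := by
  have hτ := hq.period_pos
  rw [design, mul_div_left_comm]
  exact mul_le_of_le_one_right hτ.le (div_le_one_of_le₀ (by linarith) (by positivity))

theorem step_pos (hq : q.IsUniform c Λ C) (hlN : 0 < c.lamN) : 0 < q.step c :=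
  div_pos (mul_pos (mul_pos hq.a2_pos hq.nuOfRatio_pos) (Real.sqrt_pos.2 (sub_pos.2 hq.beta_lt)))
    (mul_pos hq.ratio_pos hlN)

theorem bound_mul_period_le (hq : q.IsUniform c Λ C) : C * q.τ ≤ 1 / 32 := by
  have hτ := hq.period_pos
  have hsq : C * q.τ ≤ C ^ 2 * q.τ := by gcongr; exact le_self_pow₀ hq.one_le two_ne_zero
  linarith [hq.period_le]

theorem period_le_half (hq : q.IsUniform c Λ C) : q.τ ≤ 1 / 2 := by
  linarith [hq.bound_mul_period_le, le_mul_of_one_le_left hq.period_pos.le hq.one_le]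

theorem held_exponent_le (hq : q.IsUniform c Λ C) (hΛ : c.lamN ≤ Λ) (hγ : 0 < γ) :
    (q.design γ).α * c.lamN * (q.design γ).T ≤ 1 / 32 := by
  have hκ := hq.ratio_pos
  have hχ := hq.scale_pos
  have hτ := hq.period_pos
  have hC := hq.one_le
  have hu : 0 ≤ γ * (q.design γ).T := by simp only [design]; positivity
  calc (q.design γ).α * c.lamN * (q.design γ).T
      = q.χ * q.κ * c.lamN * (γ * (q.design γ).T) := by simp only [design]; ring
    _ ≤ C * q.τ := by
        gcongr
        exacts [le_trans (by gcongr) hq.held_le, hq.rate_mul_period_le hγ]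
    _ ≤ 1 / 32 := hq.bound_mul_period_le

theorem exp_exponents_le (hq : q.IsUniform c Λ C) (hΛ : c.lamN ≤ Λ) (hγ : 0 < γ) :
    Real.exp (rate c (q.design γ) * (q.design γ).T +
      (q.design γ).α * c.lamN * (q.design γ).T) ≤ 3 := by
  rw [hq.rate_design hγ.ne']
  refine (Real.exp_le_exp.2 ?_).trans Real.exp_one_lt_three.le
  linarith [hq.rate_mul_period_le hγ, hq.held_exponent_le hΛ hγ, hq.period_le_half]

theorem s0_design (hq : q.IsUniform c Λ C) (hγ : 0 < γ) :
    s0 c (q.design γ) = q.step c * c.M0 / Real.exp (rate c (q.design γ) * (q.design γ).T +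
      (q.design γ).α * c.lamN * (q.design γ).T) := by
  have hχ := hq.scale_pos
  rw [s0, nu_design hχ.ne' hγ.ne', neg_mul, ← neg_add', Real.exp_neg, ← div_eq_mul_inv]
  congr 1
  simp only [design, step]
  field_simp

theorem s0_design_pos (hq : q.IsUniform c Λ C) (hlN : 0 < c.lamN) (hM : 0 < c.M0) (hγ : 0 < γ) :
    0 < s0 c (q.design γ) := by
  rw [hq.s0_design hγ]
  have := hq.step_pos hlN
  positivity

theorem s0_design_le (hq : q.IsUniform c Λ C) (hlN : 0 < c.lamN) (hM : 0 < c.M0) (hγ : 0 < γ) :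
    s0 c (q.design γ) ≤ c.M0 / (8 * C) := by
  have hκ := hq.ratio_pos
  have hχ := hq.scale_pos
  have hτ := hq.period_pos
  have hS := hq.step_pos hlN
  rw [hq.s0_design hγ, hq.rate_design hγ.ne', div_eq_inv_mul c.M0, inv_eq_one_div]
  refine (div_le_self (by positivity) (Real.one_le_exp ?_)).trans (by gcongr; exact hq.step_le)
  simp only [design]
  positivity

theorem mul_M0_le_range (hq : q.IsUniform c Λ C) (hlN : 0 < c.lamN) (hΛ : c.lamN ≤ Λ)
    (hM : 0 < c.M0) (hγ : 0 < γ) :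
    (√(c.N * c.n) + 1) * c.M0 ≤ s0 c (q.design γ) * q.L := by
  have hS := hq.step_pos hlN
  have hs : q.step c * c.M0 / 3 ≤ s0 c (q.design γ) := by
    rw [hq.s0_design hγ]
    gcongr
    exact hq.exp_exponents_le hΛ hγ
  calc (√(c.N * c.n) + 1) * c.M0 = 3 * (√(c.N * c.n) + 1) * (c.M0 / 3) := by ring
    _ ≤ q.step c * q.L * (c.M0 / 3) := mul_le_mul_of_nonneg_right hq.level_range (by positivity)
    _ = q.step c * c.M0 / 3 * q.L := by ring
    _ ≤ s0 c (q.design γ) * q.L := by gcongr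

theorem period_rule (hq : q.IsUniform c Λ C) (hθ : 0 ≤ c.θ) (hlN : 0 < c.lamN)
    (hΛ : c.lamN ≤ Λ) (hγ : 0 < γ) :
    (Real.exp ((q.design γ).α * c.lamN * (q.design γ).T) - 1) *
      (Real.exp (rate c (q.design γ) * (q.design γ).T) - 1) *
      rho c (q.design γ) * (q.design γ).ε⁻¹ ≤ 1 / 4 := by
  have hκ := hq.ratio_pos
  have hχ := hq.scale_pos
  have hτ := hq.period_pos
  have hν := hq.nuOfRatio_pos
  have hβ := hq.beta_pos
  have hT : 0 ≤ (q.design γ).T := by simp only [design]; positivity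
  have hα : 0 ≤ (q.design γ).α := by simp only [design]; positivity
  have hTτ : (q.design γ).T ≤ q.τ := div_le_self hτ.le (by linarith)
  have hw := hq.held_exponent_le hΛ hγ
  have hu := (hq.rate_mul_period_le hγ).trans (hq.period_le_half.trans one_half_lt_one.le)
  have hρ : 0 ≤ rho c (q.design 1) := by
    rw [rho, nu_design hχ.ne' one_ne_zero]
    simp only [design]
    positivity
  rw [hq.rate_design hγ.ne', rho_design hχ.ne' hγ.ne', ← div_eq_mul_inv,
    div_le_iff₀ (show 0 < (q.design γ).ε from mul_pos hχ hγ)]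
  calc (Real.exp ((q.design γ).α * c.lamN * (q.design γ).T) - 1) *
        (Real.exp (γ * (q.design γ).T) - 1) * rho c (q.design 1)
      ≤ 2 * ((q.design γ).α * c.lamN * (q.design γ).T) * (2 * (γ * (q.design γ).T)) *
          rho c (q.design 1) := by
        gcongr
        exacts [sub_nonneg.2 (Real.one_le_exp (by positivity)),
          exp_sub_one_le_two_mul (by positivity) (by linarith),
          exp_sub_one_le_two_mul (by positivity) hu]
    _ ≤ 2 * (1 / 32) * (2 * (γ * q.τ)) * rho c (q.design 1) := by gcongr
    _ = γ / 8 * (q.τ * rho c (q.design 1)) := by ring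
    _ ≤ γ / 8 * q.χ := by gcongr; exact hq.period_rho_le
    _ = 1 / 8 * (q.design γ).ε := by simp only [design]; ring
    _ ≤ 1 / 4 * (q.design γ).ε := by gcongr; exacts [(mul_pos hχ hγ).le, by norm_num]

theorem admissible (hq : q.IsUniform c Λ C) (hθ : 0 ≤ c.θ) (hl : 0 < c.lam2) (hlN : 0 < c.lamN)
    (hΛ : c.lamN ≤ Λ) (hM : 0 < c.M0) (hγ : 0 < γ) : Admissible c (q.design γ) := by
  have hχ := hq.scale_pos
  have hτ := hq.period_pos
  have ha2 := hq.a2_pos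
  have hrange := hq.mul_M0_le_range hlN hΛ hM hγ
  refine ⟨mul_pos hχ hγ, ?gain, hq.beta_pos, hq.beta_lt, by norm_num [design], by norm_num [design],
    hq.a2_pos, by norm_num [design]; linarith [hq.a2_lt], by simp only [design]; positivity,
    hq.period_rule hθ hlN hΛ hγ, ?level_pos, ?level_init, ?level⟩
  case gain =>
    rw [div_mul_eq_mul_div, div_lt_iff₀ hl]
    simp only [design]
    nlinarith [mul_lt_mul_of_pos_left hq.gain (mul_pos hχ hγ)]
  case level_pos =>
    refine Nat.pos_of_ne_zero fun h0 => ?_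
    have hlevel := hq.level_range
    rw [show q.L = 0 from h0, Nat.cast_zero, mul_zero] at hlevel
    linarith [Real.sqrt_nonneg ((c.N : ℝ) * c.n)]
  case level_init =>
    rw [div_le_iff₀' (hq.s0_design_pos hlN hM hγ)]
    exact le_trans (le_mul_of_one_le_left hM.le (le_add_of_nonneg_left (Real.sqrt_nonneg _))) hrange
  case level =>
    rw [Int.ceil_le, Int.cast_natCast, sub_le_iff_le_add]
    refine ((div_le_iff₀ (mul_pos two_pos ha2)).2 ?_).trans (le_add_of_nonneg_right one_half_pos.le)
    calc √(c.N * c.n) * _ ≤ √(c.N * c.n) * 3 := by gcongr; exact hq.exp_exponents_le hΛ hγ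
      _ ≤ q.L * (2 * q.a2) := by linarith [hq.level_fine]

end IsUniform

end DesignFamily

end DesignFamily

section Existence

variable {c : Consts}

theorem exists_gains (hN : 0 < c.N) (hl : 0 < c.lam2) (hμ : 0 < c.μ) (hθ : 0 ≤ c.θ) (κ₀ : ℝ) :
    ∃ κ χ β : ℝ, κ₀ ≤ κ ∧ 0 < κ ∧ c.θ ^ 2 / c.μ + c.θ < κ * c.lam2 ∧ 0 < χ ∧ 0 < β ∧ β < 1 ∧
      χ * nuOfRatio c κ * β = 4 ∧ 2 ≤ χ * (c.μ / (4 * c.N)) := by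
  obtain ⟨κ, hκ₀, hgain⟩ : ∃ κ, κ₀ ≤ κ ∧ c.θ ^ 2 / c.μ + c.θ < κ * c.lam2 :=
    ⟨max κ₀ ((c.θ ^ 2 / c.μ + c.θ) / c.lam2 + 1), le_max_left _ _,
      (div_lt_iff₀ hl).1 ((lt_add_one _).trans_le (le_max_right _ _))⟩
  have hκ : 0 < κ := pos_of_mul_pos_left (lt_of_le_of_lt (by positivity) hgain) hl.le
  have hν := nuOfRatio_pos hN hμ hgain
  have : 0 < c.μ / (4 * c.N) := by positivity
  obtain ⟨β, hβ, hβhalf, hβm⟩ :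
      ∃ β, 0 < β ∧ β ≤ 1 / 2 ∧ β ≤ 2 * (c.μ / (4 * c.N)) / nuOfRatio c κ :=
    ⟨min _ _, lt_min one_half_pos (by positivity), min_le_left _ _, min_le_right _ _⟩
  refine ⟨κ, 4 / (nuOfRatio c κ * β), β, hκ₀, hκ, hgain, by positivity, hβ, by linarith, ?_, ?_⟩
  · rw [mul_assoc, div_mul_cancel₀ _ (by positivity)]
  · rw [le_div_iff₀ hν] at hβm
    rw [div_mul_eq_mul_div, le_div_iff₀ (by positivity)]
    linarith

theorem exists_level {S a : ℝ} (hS : 0 < S) (ha : 0 < a) (G : ℝ) :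
    ∃ L : ℕ, 3 * (G + 1) ≤ S * L ∧ 3 * G ≤ 2 * a * L := by
  obtain ⟨L, hL⟩ := exists_nat_ge (max (3 * (G + 1) / S) (3 * G / (2 * a)))
  exact ⟨L, (div_le_iff₀' hS).1 ((le_max_left _ _).trans hL),
    (div_le_iff₀' (by positivity)).1 ((le_max_right _ _).trans hL)⟩

theorem DesignFamily.exists_isUniform (hN : 0 < c.N) (hl : 0 < c.lam2) (hlN : 0 < c.lamN)
    (hμ : 0 < c.μ) (hθ : 0 ≤ c.θ) (κ₀ : ℝ) {Λ : ℝ} (hΛ : 0 ≤ Λ) :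
    ∃ (q : DesignFamily) (C : ℝ), κ₀ ≤ q.κ ∧ ∀ M0, q.IsUniform { c with M0 := M0 } Λ C := by
  obtain ⟨κ, χ, β, hκ₀, hκ, hgain, hχ, hβ, hβ1, hscale, hcoer⟩ := exists_gains hN hl hμ hθ κ₀
  have hν := nuOfRatio_pos hN hμ hgain
  have : 0 < √(1 - β) := Real.sqrt_pos.2 (by linarith)
  have hheld : 0 ≤ χ * κ * Λ := by positivity
  have hcurrent : 0 ≤ χ * c.θ := by positivity
  set C := 1 + χ * κ * Λ + χ * c.θ
  have : 0 < C := by positivity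
  obtain ⟨a₂, ha₂, ha₂half, ha₂C⟩ :
      ∃ a₂, 0 < a₂ ∧ a₂ ≤ 1 / 2 ∧ a₂ ≤ κ * c.lamN / (8 * C * nuOfRatio c κ) :=
    ⟨min _ _, lt_min one_half_pos (by positivity), min_le_left _ _, min_le_right _ _⟩
  have hρ : 0 < (c.θ / (κ * c.lamN) + 1) *
      (8 * κ * c.lamN / (nuOfRatio c κ ^ 2 * β * √(1 - β))) := by positivity
  obtain ⟨τ, hτ, hτC, hτρ⟩ : ∃ τ, 0 < τ ∧ τ ≤ 1 / (32 * C ^ 2) ∧ τ ≤ χ / _ :=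
    ⟨min _ _, lt_min (by positivity) (div_pos hχ hρ), min_le_left _ _, min_le_right _ _⟩
  have hS : a₂ * nuOfRatio c κ * √(1 - β) / (κ * c.lamN) ≤ 1 / (8 * C) := by
    rw [div_le_div_iff₀ (by positivity) (by positivity)]
    rw [le_div_iff₀ (by positivity)] at ha₂C
    nlinarith [mul_le_mul_of_nonneg_left (Real.sqrt_le_one.2 (by linarith : 1 - β ≤ 1))
      (by positivity : 0 ≤ a₂ * (8 * C * nuOfRatio c κ))]
  obtain ⟨L, hrange, hfine⟩ := exists_level (S := a₂ * nuOfRatio c κ * √(1 - β) / (κ * c.lamN))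
    (by positivity) ha₂ √(c.N * c.n)
  refine ⟨⟨κ, χ, β, a₂, τ, L⟩, C, hκ₀, fun M0 => ⟨hgain, hκ, hχ, hscale, hcoer, hβ, hβ1, ha₂,
    by linarith, by linarith, by linarith, by linarith, hτ,
    (le_div_iff₀' (by positivity)).1 hτC, ?_, hS, hrange, hfine⟩⟩
  rw [rho_eq (mul_ne_zero hχ.ne' one_ne_zero) rfl]
  exact (le_div_iff₀ hρ).1 hτρ

end Existence

section Convergence

variable {W : CommGraph N} {J : Fin N → Profile d → ℝ} {μ : ℝ} {θown θother : Fin N → ℝ}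
  {hN : 2 ≤ N} {M M' Λ C γ : ℝ} {q : DesignFamily}

namespace DesignFamily.IsUniform

theorem isDissipative (hF : MonotoneLipschitz J μ θown θother)
    (hq : q.IsUniform (consts W hN d μ θown θother M M') Λ C) (hΛ : ‖W.lap d‖ ≤ Λ) {xs : Profile d}
    (hxs : gameMap J xs = 0)
    (hcoer : ∀ y : Stack d, μ / (4 * N) * ‖y‖ ^ 2 ≤
      q.κ * inner ℝ y (W.lap d y) + inner ℝ y (gradStack J (consensus xs + y))) (hγ : 0 < γ) :
    IsDissipative ((q.design γ).α • W.lap d)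
      (fun v => (q.design γ).ε • gradStack J (consensus xs + v)) γ C := by
  have hκ := hq.ratio_pos
  have hχ := hq.scale_pos
  refine ⟨fun v => ?coercive, fun v => ?held, fun v => ?current⟩ <;> simp only [design]
  case coercive =>
    rw [inner_add_right, smul_apply, real_inner_smul_right, real_inner_smul_right]
    calc 2 * γ * ‖v‖ ^ 2 ≤ q.χ * (μ / (4 * N)) * γ * ‖v‖ ^ 2 := by
          gcongr; exact hq.coercivity
      _ = q.χ * γ * (μ / (4 * N) * ‖v‖ ^ 2) := by ring
      _ ≤ q.χ * γ * _ := mul_le_mul_of_nonneg_left (hcoer v) (by positivity)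
      _ = _ := by ring
  case held =>
    rw [smul_apply, norm_smul, Real.norm_of_nonneg (by positivity)]
    calc q.κ * (q.χ * γ) * ‖W.lap d v‖ ≤ q.κ * (q.χ * γ) * (Λ * ‖v‖) := by
          gcongr; exact (W.lap d).le_of_opNorm_le hΛ v
      _ = q.χ * q.κ * Λ * γ * ‖v‖ := by ring
      _ ≤ C * γ * ‖v‖ := by gcongr; exact hq.held_le
  case current =>
    have hlip := (hF.lipschitzWith_gradStack_add (consensus xs)).norm_sub_le v 0
    rw [add_zero, gradStack_consensus_eq_zero hxs, sub_zero, sub_zero,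
      Real.coe_toNNReal _ (theta_nonneg _ _)] at hlip
    rw [norm_smul, Real.norm_of_nonneg (by positivity)]
    calc q.χ * γ * ‖gradStack J (consensus xs + v)‖
        ≤ q.χ * γ * (theta θown θother * ‖v‖) := by gcongr
      _ = q.χ * theta θown θother * γ * ‖v‖ := by ring
      _ ≤ C * γ * ‖v‖ := by gcongr; exact hq.current_le

theorem exists_isSolution (hF : MonotoneLipschitz J μ θown θother)
    (hq : q.IsUniform (consts W hN d μ θown θother M M') Λ C) (hγ : 0 < γ) (z : Stack d) :
    ∃ x, IsSolution W J (consts W hN d μ θown θother M M') (q.design γ) x ∧ x 0 = z := by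
  have hχ := hq.scale_pos
  have hτ := hq.period_pos
  have hC := hq.one_le
  have hT : 0 < (q.design γ).T := by simp only [design]; positivity
  refine QuantizedNash.exists_isSolution hF.lipschitzWith_gradStack (mul_pos hχ hγ).le hT ?_ z
  rw [Real.coe_toNNReal _ (theta_nonneg _ _)]
  calc q.χ * γ * theta θown θother * (q.design γ).T
      = q.χ * theta θown θother * (γ * (q.design γ).T) := by ring
    _ ≤ C * q.τ := by
        gcongr
        exacts [hq.current_le, hq.rate_mul_period_le hγ]
    _ ≤ 1 / 2 := by linarith [hq.bound_mul_period_le]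

theorem norm_sub_consensus_le (hF : MonotoneLipschitz J μ θown θother)
    (hW : W.graph.Connected) (hq : q.IsUniform (consts W hN d μ θown θother M M') Λ C)
    (hΛ : max ‖W.lap d‖ (W.lamN hN) ≤ Λ) {xs : Profile d} (hxs : gameMap J xs = 0)
    (hcoer : ∀ y : Stack d, μ / (4 * N) * ‖y‖ ^ 2 ≤
      q.κ * inner ℝ y (W.lap d y) + inner ℝ y (gradStack J (consensus xs + y)))
    (hM : 0 < M + M') (hxsM : SupBound xs M') (hγ : 0 < γ) {x : ℝ → Stack d}
    (hx : IsSolution W J (consts W hN d μ θown θother M M') (q.design γ) x)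
    (hx0 : ∀ i, SupBound (x 0 i) M) {t : ℝ} (ht : 0 ≤ t) :
    ‖x t - consensus xs‖ ≤ (√(N * (∑ i, d i : ℕ)) + 1) * (M + M') * Real.exp (-γ * t) := by
  set c := consts W hN d μ θown θother M M'
  have hlN : 0 < c.lamN := W.lamN_pos hN hW
  have hC := hq.one_le
  have hτ := hq.period_pos
  have hrate := hq.rate_design hγ.ne'
  have hdiss : IsDissipative ((q.design γ).α • W.lap d)
      (fun v => (q.design γ).ε • gradStack J (consensus xs + v)) (rate c (q.design γ)) C := by
    rw [hrate]
    exact hq.isDissipative hF ((le_max_left _ _).trans hΛ) hxs hcoer hγ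
  have hs := hq.s0_design_pos hlN hM hγ
  set G := √(N * (∑ i, d i : ℕ))
  have hGY : G * (M + M') ≤ (G + 1) * (M + M') := by gcongr; linarith
  have hMY : M + M' ≤ (G + 1) * (M + M') :=
    le_mul_of_one_le_left hM.le (le_add_of_nonneg_left (Real.sqrt_nonneg _))
  have hrange : (G + 1) * (M + M') ≤ s0 c (q.design γ) * (q.L + 1 / 2) :=
    (hq.mul_M0_le_range hlN ((le_max_right _ _).trans hΛ) hM hγ).trans (by gcongr; linarith)
  have hperiod : 32 * C ^ 2 * rate c (q.design γ) * (q.design γ).T ≤ 1 := by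
    rw [hrate, mul_assoc]
    exact le_trans (by gcongr; exact hq.rate_mul_period_le hγ) hq.period_le
  have hfine : G * (s0 c (q.design γ) / 2) ≤ (G + 1) * (M + M') / (16 * C) :=
    calc G * (s0 c (q.design γ) / 2) ≤ G * ((M + M') / (8 * C) / 2) := by
          gcongr; exact hq.s0_design_le hlN hM hγ
      _ = G * (M + M') / (16 * C) := by ring
      _ ≤ (G + 1) * (M + M') / (16 * C) := by gcongr
  have hdist : ‖x 0 - consensus xs‖ ≤ G * (M + M') := norm_le_of_supBound hM.le fun i j k =>
    (abs_sub _ _).trans (add_le_add (hx0 i j k) (hxsM j k))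
  have hdecay := hx.norm_sub_consensus_le (hrate.symm ▸ hγ) (div_pos hτ (by positivity)) hs hC
    hperiod hdiss hfine (hM.trans_le hMY) hrange (hdist.trans hGY) (fun i j k => ?_) ht
  · rwa [hrate] at hdecay
  · have hM' : 0 ≤ M' := (abs_nonneg _).trans (hxsM j k)
    exact (hx0 i j k).trans ((le_add_of_nonneg_right hM').trans (hMY.trans hrange))

theorem convergesToNash (hJ : RegularCosts J) (hF : MonotoneLipschitz J μ θown θother)
    (hW : W.graph.Connected) (hq : q.IsUniform (consts W hN d μ θown θother M M') Λ C)
    (hΛ : max ‖W.lap d‖ (W.lamN hN) ≤ Λ)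
    (hcoer : ∀ x, gameMap J x = 0 → ∀ y : Stack d, μ / (4 * N) * ‖y‖ ^ 2 ≤
      q.κ * inner ℝ y (W.lap d y) + inner ℝ y (gradStack J (consensus x + y)))
    (hM : 0 < M + M') (hnash : ∀ xs : Profile d, IsNash J xs → SupBound xs M') (hγ : 0 < γ) :
    ConvergesToNash W J (consts W hN d μ θown θother M M') (q.design γ) M γ := by
  obtain ⟨xs, hxs⟩ := hF.exists_gameMap_eq_zero
  have hxs_nash : IsNash J xs :=
    isNash_of_gameMap_eq_zero (fun i => (hJ.strictConvex i xs).convexOn)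
      (fun i => ((hJ.contDiff i xs).differentiable one_ne_zero).differentiableAt) hxs
  exact ⟨fun z _ => hq.exists_isSolution hF hγ z, xs, hxs_nash, _, fun x hx hx0 t ht =>
    hq.norm_sub_consensus_le hF hW hΛ hxs (hcoer xs hxs) hM (hnash xs hxs_nash) hγ hx hx0 ht⟩

end DesignFamily.IsUniform

theorem exists_convergent_designs (hN : 2 ≤ N) (hJ : RegularCosts J)
    (hF : MonotoneLipschitz J μ θown θother) (hW : W.graph.Connected) :
    ∃ q : DesignFamily, 0 < q.τ ∧ ∀ M M' : ℝ, 0 < M + M' →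
      (∀ xs : Profile d, IsNash J xs → SupBound xs M') → ∀ γ : ℝ, 0 < γ →
        Admissible (consts W hN d μ θown θother M M') (q.design γ) ∧
        rate (consts W hN d μ θown θother M M') (q.design γ) = γ ∧
        ConvergesToNash W J (consts W hN d μ θown θother M M') (q.design γ) M γ := by
  have hl := W.lam2_pos hN hW
  have hlN := W.lamN_pos hN hW
  have hθ := theta_nonneg θown θother
  obtain ⟨κ₀, hκ₀⟩ := hF.exists_coercive_gain hW ⟨0, by omega⟩
  obtain ⟨q, C, hκ, hq⟩ := DesignFamily.exists_isUniform
    (c := consts W hN d μ θown θother 0 0) (by simp only [consts]; omega) hl hlN hF.mu_pos hθ κ₀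
    (le_max_of_le_left (norm_nonneg (W.lap d)) : 0 ≤ max ‖W.lap d‖ (W.lamN hN))
  refine ⟨q, (hq 0).period_pos, fun M M' hM hnash γ hγ => ?_⟩
  have hqM : q.IsUniform (consts W hN d μ θown θother M M') _ C := hq (M + M')
  exact ⟨hqM.admissible hθ hl hlN (le_max_right _ _) hM hγ, hqM.rate_design hγ.ne',
    hqM.convergesToNash hJ hF hW le_rfl (hκ₀ q.κ hκ) hM hnash hγ⟩

end Convergence

end QuantizedNash
end

theorem theorem3 {N : ℕ} (hN : 2 ≤ N) (W : CommGraph N) (hW : W.graph.Connected)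
    (d : Fin N → ℕ) (J : Fin N → Profile d → ℝ) (μ : ℝ) (θown θother : Fin N → ℝ)
    (hJ : RegularCosts J) (hF : MonotoneLipschitz J μ θown θother) :
    ∃ c₁ c₂ : ℝ, 0 < c₁ ∧ 0 < c₂ ∧
      ∀ M M' : ℝ, 0 < M + M' → (∀ xs : Profile d, IsNash J xs → SupBound xs M') →
        ∀ γ : ℝ, 0 < γ →
          (∃ B ∈ sufficientBandwidths W J (consts W hN d μ θown θother M M') M γ,
            B ≤ c₁ * γ + c₂) ∧
          minBandwidth W J (consts W hN d μ θown θother M M') M γ ≤ c₁ * γ + c₂ := by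
  obtain ⟨q, hτ, hq⟩ := exists_convergent_designs hN hJ hF hW
  set r := ((∑ i, d i : ℕ) : ℝ) * Real.logb 2 (2 * (q.L : ℝ) + 1)
  have hr : 0 ≤ r / q.τ := div_nonneg (message_bits_nonneg _ _) hτ.le
  refine ⟨r / q.τ + 1, r / q.τ + 1, by positivity, by positivity, fun M M' hM hnash γ hγ => ?_⟩
  obtain ⟨hadm, hrate, hconv⟩ := hq M M' hM hnash γ hγ
  have hB : designBandwidth W (consts W hN d μ θown θother M M') (q.design γ) ≤
      (r / q.τ + 1) * γ + (r / q.τ + 1) :=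
    calc designBandwidth W (consts W hN d μ θown θother M M') (q.design γ)
        ≤ r / (q.τ / (γ + 1)) := designBandwidth_le W hadm.period_pos
      _ = r / q.τ * (γ + 1) := by rw [div_div_eq_mul_div, mul_div_right_comm]
      _ ≤ (r / q.τ + 1) * γ + (r / q.τ + 1) := by linarith
  have hmem : designBandwidth W (consts W hN d μ θown θother M M') (q.design γ) ∈
      sufficientBandwidths W J (consts W hN d μ θown θother M M') M γ :=
    ⟨_, hadm, hrate, hconv, rfl⟩
  refine ⟨⟨_, hmem, hB⟩, (csInf_le ⟨0, ?_⟩ hmem).trans hB⟩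
  rintro _ ⟨p, hp, -, -, rfl⟩
  exact designBandwidth_nonneg W hp.period_pos
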